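/- Let $G\subseteq\mathbb{R}^d$ with Borel $\sigma$-algebra $\mathcal{B}(G)$, let $K$ be a Markov transition kernel on $(G,\mathcal{B}(G))$ that is reversible with respect to a probability measure $\pi$, i.e. $\int_A K(x,B)\,\pi(dx)=\int_B K(x,A)\,\pi(dx)$ for all $A,B\in\mathcal{B}(G)$. Let $L_2=L_2(\pi)$ (real-valued functions, norm $\|\cdot\|_2$), $L_2^0=\{f\in L_2:\int f\,d\pi=0\}$, let $Pf(x)=\int_G f(y)\,K(x,dy)$ be the Markov operator on $L_2$, which maps $L_2^0$ into itself, and put $$\Lambda=\sup\operatorname{spec}(P|_{L_2^0}),\qquad \Lambda_0=\max\{0,\Lambda\}$$ (with $\Lambda_0=0$ if $L_2^0=\{0\}$). Assume that $K$ is variance bounding, i.e. $\Lambda<1$. Let $\nu$ be a probability measure on $(G,\mathcal{B}(G))$ that has a density $\frac{d\nu}{d\pi}\in L_2$. Let $\mathscr{A}\subseteq\mathcal{B}(G)$, let $\delta>0$, and let $\Gamma_\delta\subseteq\mathcal{B}(G)$ be a finite $\delta$-cover of $\mathscr{A}$ with respect to $\pi$, i.e. $\emptyset\in\Gamma_\delta$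 and for every $A\in\mathscr{A}$ there are $C,D\in\Gamma_\delta$ with $C\subseteq A\subseteq D$ and $\pi(D\setminus C)\le\delta$. Let $\varphi\colon G\times[0,1]^s\to G$ be any update function of $K$ (measurable, with $K(x,A)=\lambda_s(\{u\in[0,1]^s:\varphi(x;u)\in A\})$ for all $x\in G$, $A\in\mathcal{B}(G)$) and let $\psi\colon[0,1]^s\to G$ be any generator function of $\nu$ (measurable, with $\nu(A)=\lambda_s(\{u\in[0,1]^s:\psi(u)\in A\})$ for all $A\in\mathcal{B}(G)$), where $\lambda_k$ is the Lebesgue measure on $[0,1]^k$. Put $\varphi_0(x)=x$, $\varphi_{i}(x;u_1,\dots,u_{i})=\varphi(\varphi_{i-1}(x;u_1,\dots,u_{i-1});u_{i})$ for $i\ge1$, and $$C_{i,\psi}(A)=\{(u_0,\dots,u_i)\in[0,1]^{(i+1)s}:\varphi_i(\psi(u_0);u_1,\dots,u_i)\in A\},\qquad i\ge 0.$$ For a driver sequence $\mathcal{U}_n=(u_0,\dots,u_{n-1})$ in $[0,1]^s$ the pull-back discrepancy is $$D^*_{\mathscr{A},\psi,\varphi}(\mathcal{U}_n)=\sup_{A\in\mathscr{A}}\left|\frac1n\sum_{i=0}^{n-1}\Big[1_{(u_0,\dots,u_i)\in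 C_{i,\psi}(A)}-\lambda_{(i+1)s}(C_{i,\psi}(A))\Big]\right|$$ (a supremum over the empty set being $0$). Then for every integer $n\ge1$ there exists a driver sequence $\mathcal{U}_n=(u_0,\dots,u_{n-1})$ in $[0,1]^s$ such that $$D^*_{\mathscr{A},\psi,\varphi}(\mathcal{U}_n)\le\sqrt{\frac{1+\Lambda_0}{1-\Lambda_0}}\cdot\frac{\sqrt{2\log\big(|\Gamma_\delta|^2\,\|\frac{d\nu}{d\pi}\|_2\big)}}{\sqrt n}+\frac{1-\Lambda_0^n}{n(1-\Lambda_0)}\left\|\frac{d\nu}{d\pi}-1\right\|_2+\delta .$$ -/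

import Mathlib

open MeasureTheory ProbabilityTheory
open scoped ENNReal

namespace PullBack

noncomputable section

section MarkovOperator

variable {α : Type*} [MeasurableSpace α] {K : Kernel α α} {π : Measure α}

/-- Kernel averages of a square integrable function are square integrable with respect to an
invariant probability measure, and averaging does not increase the `L₂` norm. -/
theorem eLpNorm_kernelMean_le [IsMarkovKernel K] (hK : K.Invariant π)
    {f : α → ℝ} (hf : StronglyMeasurable f) :
    eLpNorm (fun x => ∫ y, f y ∂(K x)) 2 π ≤ eLpNorm f 2 π := by
  have key : ∀ x, ‖∫ y, f y ∂(K x)‖ₑ ^ (2 : ℝ) ≤ ∫⁻ y, ‖f y‖ₑ ^ (2 : ℝ) ∂(K x) := by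
    intro x
    have h1 : ‖∫ y, f y ∂(K x)‖ₑ ≤ eLpNorm f 1 (K x) := by
      rw [eLpNorm_one_eq_lintegral_enorm]
      exact enorm_integral_le_lintegral_enorm f
    have h2 : eLpNorm f 1 (K x) ≤ eLpNorm f 2 (K x) :=
      eLpNorm_le_eLpNorm_of_exponent_le (by norm_num) hf.aestronglyMeasurable
    have h3 : eLpNorm f 2 (K x) ^ (2 : ℝ) = ∫⁻ y, ‖f y‖ₑ ^ (2 : ℝ) ∂(K x) := by
      simpa using eLpNorm_nnreal_pow_eq_lintegral (f := f) (μ := K x) (p := 2) (by norm_num)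
    rw [← h3]
    exact ENNReal.rpow_le_rpow (h1.trans h2) (by norm_num)
  have h4 : ∀ g : α → ℝ, eLpNorm g 2 π ^ (2 : ℝ) = ∫⁻ y, ‖g y‖ₑ ^ (2 : ℝ) ∂π := fun g => by
    simpa using eLpNorm_nnreal_pow_eq_lintegral (f := g) (μ := π) (p := 2) (by norm_num)
  have h5 : ∫⁻ x, ∫⁻ y, ‖f y‖ₑ ^ (2 : ℝ) ∂(K x) ∂π = ∫⁻ y, ‖f y‖ₑ ^ (2 : ℝ) ∂π := by
    conv_rhs => rw [← hK.def]
    rw [Measure.lintegral_bind K.aemeasurable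
      ((hf.enorm.pow_const (2 : ℝ)).aemeasurable)]
  rw [← ENNReal.rpow_le_rpow_iff (z := (2 : ℝ)) (by norm_num), h4, h4, ← h5]
  exact lintegral_mono key

theorem memLp_kernelMean [IsMarkovKernel K] (hK : K.Invariant π) (f : Lp ℝ 2 π) :
    MemLp (fun x => ∫ y, f y ∂(K x)) 2 π :=
  ⟨((Lp.stronglyMeasurable f).integral_kernel).aestronglyMeasurable,
    (eLpNorm_kernelMean_le hK (Lp.stronglyMeasurable f)).trans_lt (Lp.eLpNorm_lt_top f)⟩

theorem kernelMean_congr (hK : K.Invariant π) {f g : α → ℝ} (h : f =ᵐ[π] g) :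
    (fun x => ∫ y, f y ∂(K x)) =ᵐ[π] fun x => ∫ y, g y ∂(K x) := by
  rw [← hK.def] at h
  filter_upwards [Measure.ae_ae_of_ae_comp h] with x hx using integral_congr_ae hx

theorem ae_integrable_kernel [IsProbabilityMeasure π] (hK : K.Invariant π) (f : Lp ℝ 2 π) :
    ∀ᵐ x ∂π, Integrable f (K x) := by
  have h : Integrable f π := (Lp.memLp f).integrable (by norm_num)
  have h' : Integrable f (π.bind K) := by rwa [hK.def]
  exact Measure.ae_integrable_of_integrable_comp h'

/-- The Markov operator `P f (x) = ∫ f(y) K(x, dy)` on the real Hilbert space `L₂(π)`, for a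
Markov kernel `K` with invariant probability measure `π`. -/
def markovOperator (K : Kernel α α) (π : Measure α) [IsMarkovKernel K] [IsProbabilityMeasure π]
    (hK : K.Invariant π) : Lp ℝ 2 π →L[ℝ] Lp ℝ 2 π :=
  LinearMap.mkContinuous
    { toFun := fun f => (memLp_kernelMean hK f).toLp (fun x => ∫ y, f y ∂(K x))
      map_add' := fun f g => by
        rw [← MemLp.toLp_add, MemLp.toLp_eq_toLp_iff]
        filter_upwards [kernelMean_congr hK (Lp.coeFn_add f g), ae_integrable_kernel hK f,
          ae_integrable_kernel hK g] with x hx hf hg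
        rw [hx]
        exact integral_add hf hg
      map_smul' := fun c f => by
        rw [RingHom.id_apply, ← MemLp.toLp_const_smul, MemLp.toLp_eq_toLp_iff]
        filter_upwards [kernelMean_congr hK (Lp.coeFn_smul c f)] with x hx
        rw [hx]
        exact integral_smul c _ }
    1 (fun f => by
      rw [one_mul]
      change ‖(memLp_kernelMean hK f).toLp (fun x => ∫ y, f y ∂(K x))‖ ≤ ‖f‖
      rw [Lp.norm_toLp, Lp.norm_def]
      exact ENNReal.toReal_mono (Lp.eLpNorm_ne_top f)
        (eLpNorm_kernelMean_le hK (Lp.stronglyMeasurable f)))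

theorem markovOperator_coeFn [IsMarkovKernel K] [IsProbabilityMeasure π] (hK : K.Invariant π)
    (f : Lp ℝ 2 π) : markovOperator K π hK f =ᵐ[π] fun x => ∫ y, f y ∂(K x) :=
  MemLp.coeFn_toLp (memLp_kernelMean hK f)

/-- The subspace `L₂⁰(π)` of the functions in `L₂(π)` with mean zero. -/
def L2Zero (π : Measure α) [IsProbabilityMeasure π] : Submodule ℝ (Lp ℝ 2 π) where
  carrier := {f | ∫ x, f x ∂π = 0}
  zero_mem' := by
    change ∫ x, (0 : Lp ℝ 2 π) x ∂π = 0
    rw [integral_congr_ae (Lp.coeFn_zero ℝ 2 π)]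
    simp
  add_mem' := fun {f g} hf hg => by
    change ∫ x, (f + g : Lp ℝ 2 π) x ∂π = 0
    rw [integral_congr_ae (Lp.coeFn_add f g)]
    change ∫ x, (f x + g x) ∂π = 0
    rw [integral_add ((Lp.memLp f).integrable (by norm_num))
      ((Lp.memLp g).integrable (by norm_num)), hf, hg, add_zero]
  smul_mem' := fun c f hf => by
    change ∫ x, (c • f : Lp ℝ 2 π) x ∂π = 0
    rw [integral_congr_ae (Lp.coeFn_smul c f)]
    change ∫ x, c • f x ∂π = 0
    rw [integral_smul, hf, smul_zero]

theorem markovOperator_mem_L2Zero [IsMarkovKernel K] [IsProbabilityMeasure π]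
    (hK : K.Invariant π) (f : Lp ℝ 2 π) (hf : f ∈ L2Zero π) :
    markovOperator K π hK f ∈ L2Zero π := by
  have h : Integrable f π := (Lp.memLp f).integrable (by norm_num)
  change ∫ x, markovOperator K π hK f x ∂π = 0
  rw [integral_congr_ae (markovOperator_coeFn hK f)]
  have h' : Integrable f (π.bind K) := by rwa [hK.def]
  rw [Measure.comp_eq_comp_const_apply] at h'
  have h2 := Kernel.integral_comp h'
  rw [← Measure.comp_eq_comp_const_apply, Kernel.const_apply, hK.def] at h2
  rw [← h2]
  exact hf

/-- The restriction of the Markov operator to `L₂⁰(π)`. -/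
def markovOperatorZero (K : Kernel α α) (π : Measure α) [IsMarkovKernel K]
    [IsProbabilityMeasure π] (hK : K.Invariant π) : L2Zero π →L[ℝ] L2Zero π :=
  (markovOperator K π hK).restrict (markovOperator_mem_L2Zero hK)

/-- `Λ = sup spec(P | L₂⁰(π))` for a kernel `K` reversible with respect to `π`. (The supremum
is `0` if `L₂⁰(π)` is trivial, in which case the spectrum is empty.) -/
def specSup (K : Kernel α α) (π : Measure α) [IsMarkovKernel K] [IsProbabilityMeasure π]
    (hK : K.IsReversible π) : ℝ :=
  sSup (spectrum ℝ (markovOperatorZero K π hK.invariant))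

/-- `K`, reversible with respect to `π`, is variance bounding (has an `L₂`-spectral gap). -/
def VarianceBounding (K : Kernel α α) (π : Measure α) [IsMarkovKernel K]
    [IsProbabilityMeasure π] (hK : K.IsReversible π) : Prop :=
  specSup K π hK < 1

/-- `Λ₀ = max {0, Λ}`. -/
def specSup₀ (K : Kernel α α) (π : Measure α) [IsMarkovKernel K] [IsProbabilityMeasure π]
    (hK : K.IsReversible π) : ℝ :=
  max 0 (specSup K π hK)

end MarkovOperator

section Discrepancy

/-- The unit cube `[0,1]^s`; its canonical measure `volume` is the Lebesgue measure. -/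
abbrev Cube (s : ℕ) : Type := Fin s → unitInterval

variable {α : Type*} [MeasurableSpace α] {s : ℕ}

/-- `φ` is an update function of the transition kernel `K`. -/
structure IsUpdateFunction (K : Kernel α α) (φ : α → Cube s → α) : Prop where
  measurable : Measurable (Function.uncurry φ)
  kernel_eq : ∀ x A, MeasurableSet A → K x A = volume {u | φ x u ∈ A}

/-- `ψ` is a generator function of the distribution `ν`. -/
structure IsGeneratorFunction (ν : Measure α) (ψ : Cube s → α) : Prop where
  measurable : Measurable ψ
  measure_eq : ∀ A, MeasurableSet A → ν A = volume {u | ψ u ∈ A}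

/-- `Γ` is a finite `δ`-cover of the set `𝒜` of test sets with respect to `π`. -/
structure IsDeltaCover (π : Measure α) (𝒜 : Set (Set α)) (δ : ℝ) (Γ : Finset (Set α)) :
    Prop where
  measurableSet : ∀ C ∈ Γ, MeasurableSet C
  empty_mem : ∅ ∈ Γ
  exists_bracket : ∀ A ∈ 𝒜, ∃ C ∈ Γ, ∃ D ∈ Γ, C ⊆ A ∧ A ⊆ D ∧ π.real (D \ C) ≤ δ

/-- The iterated update `φ_i(x; u_1, …, u_i)`. -/
def iterUpdate {β γ : Type*} (φ : β → γ → β) : (i : ℕ) → β → (Fin i → γ) → β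
  | 0, x, _ => x
  | i + 1, x, u => φ (iterUpdate φ i x (Fin.init u)) (u (Fin.last i))

/-- The set `C_{i,ψ}(A)` of all `(u_0, …, u_i)` with `φ_i(ψ(u_0); u_1, …, u_i) ∈ A`. -/
def pullBack {β γ : Type*} (φ : β → γ → β) (ψ : γ → β) (i : ℕ) (A : Set β) :
    Set (Fin (i + 1) → γ) :=
  {u | iterUpdate φ i (ψ (u 0)) (Fin.tail u) ∈ A}

/-- The local discrepancy function
`(1/n) ∑_{i=0}^{n-1} [1_{(u_0,…,u_i) ∈ C_{i,ψ}(A)} - λ_{(i+1)s}(C_{i,ψ}(A))]`. -/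
def localDiscrepancy {β : Type*} (φ : β → Cube s → β) (ψ : Cube s → β) {n : ℕ}
    (u : Fin n → Cube s) (A : Set β) : ℝ :=
  (1 / (n : ℝ)) * ∑ i : Fin n,
    ((pullBack φ ψ (i : ℕ) A).indicator (fun _ => (1 : ℝ))
        (fun j : Fin ((i : ℕ) + 1) => u (Fin.castLE i.isLt j))
      - (volume : Measure (Fin ((i : ℕ) + 1) → Cube s)).real (pullBack φ ψ (i : ℕ) A))

/-- The pull-back discrepancy of the driver sequence `u_0, …, u_{n-1}`. -/
def pullBackDiscrepancy {β : Type*} (𝒜 : Set (Set β)) (φ : β → Cube s → β) (ψ : Cube s → β)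
    {n : ℕ} (u : Fin n → Cube s) : ℝ :=
  ⨆ A : 𝒜, |localDiscrepancy φ ψ u (A : Set β)|

end Discrepancy

end

end PullBack

/-! Let the driver points be independent and uniform. For a test set `A` the local discrepancy is
the fluctuation of the visits to `A` about `n π(A)`, minus the bias of the chain started from `ν`.
Bracketing by the cover reduces the fluctuation to finitely many sets at cost `δ`, and a union bound
over these leaves a good driver sequence.

Fluctuation. Write `l = Λ₀`, `C = (1 + l) / (1 - l)`. For the stationary chain the moment generating
function of the visits to `B` is `⟨m, Qⁿ⁻¹ m⟩`, where `m = exp (θ/2 1_B)` and `Q g = m K(m g)`. The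
spectral gap puts the quadratic form of `K` below that of `l id + (1 - l) π` (`markovForm_self_le`).
For the latter kernel, `Q` becomes a multiplication operator plus a rank-one term, and its form is
at most `R = exp (θ p + θ² C / 4)`, `p = π(B)`, as soon as a scalar resolvent inequality holds
(`resolvent_le_one`, `quadratic_tilt_le`). Positivity of `K` gives the matching lower bound, so `‖Q‖
≤ R`. Chernoff's method yields the stationary tail `2 exp (-n t² / C)`. Passing to `ν` by
Cauchy–Schwarz costs the factor `‖dν/dπ‖₂` and a square root of the probability; the root halves the
exponent, whence the 2 before the logarithm.

Bias. It is the pairing of `dν/dπ - 1` with `∑ Pⁱ (1_A - π(A))`. The form of `P` on `L₂⁰` lies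
between `-1` and `l`, so the sum of powers has norm at most `∑ lⁱ` (`norm_sum_pow_apply_le`). -/

namespace PullBack

/-! ### Scalar inequalities behind the exponential moment bound -/

open Real in
-- Equality holds at 0, and the difference of the two sides has derivative `1 - (1 - t) cosh t`,
-- which is nonnegative because `(1 - t) exp t ≤ 1`.
theorem exp_le_one_add_add_mul_sinh {x : ℝ} (hx : 0 ≤ x) : exp x ≤ 1 + x + x * sinh x := by
  have hmono : MonotoneOn (fun t : ℝ => 1 + t + t * sinh t - exp t) (Set.Ici 0) := by
    apply monotoneOn_of_deriv_nonneg (convex_Ici 0)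
    · fun_prop
    · fun_prop
    · intro t _
      have hd : HasDerivAt (fun t : ℝ => 1 + t + t * sinh t - exp t)
          (1 + (1 * sinh t + t * cosh t) - exp t) t :=
        (((hasDerivAt_id t).const_add 1).add ((hasDerivAt_id t).mul (hasDerivAt_sinh t))).sub
          (hasDerivAt_exp t)
      rw [hd.deriv]
      have ht : 0 ≤ t := by simp_all [le_of_lt]
      have h1 : (1 - t) * exp t ≤ 1 := by
        have h := add_one_le_exp (-t)
        calc (1 - t) * exp t ≤ exp (-t) * exp t := by gcongr; linarith
          _ = 1 := by rw [← exp_add]; simp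
      have h2 : cosh t ≤ exp t := by
        rw [cosh_eq]; linarith [exp_le_exp.2 (by linarith : -t ≤ t)]
      have h3 : (1 - t) * cosh t ≤ 1 := by
        rcases le_total t 1 with h | h
        · exact (mul_le_mul_of_nonneg_left h2 (by linarith)).trans h1
        · nlinarith [cosh_pos t]
      have h4 : exp t = cosh t + sinh t := (cosh_add_sinh t).symm
      rw [h4]; linarith
  have h := hmono (Set.self_mem_Ici) (Set.mem_Ici.2 hx) hx
  simp at h
  linarith

open Real in
-- This is `resolvent_le_one` after normalisation, with `c = (1 + l) / (1 - l)`, `a = 2p - 1`, `x =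
-- θ/2`. The new argument is `t x` with `t = a + c x`: for `t ≥ 1` monotonicity suffices, and `t ≤
-- 1` is the delicate case.
theorem cosh_add_sinh_le_of_nonneg {c a x : ℝ} (hc : 1 ≤ c) (ha : a ≤ 1)
    (hx : 0 ≤ x) :
    c * cosh x + a * sinh x ≤ c * cosh (a * x + c * x ^ 2) + sinh (a * x + c * x ^ 2) := by
  have hs : 0 ≤ sinh x := sinh_nonneg_iff.2 hx
  obtain ⟨t, ht⟩ : ∃ t, t = a + c * x := ⟨_, rfl⟩
  have hy : a * x + c * x ^ 2 = t * x := by rw [ht]; ring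
  rw [hy]
  rcases le_total 1 t with h | h
  · have h1 : x ≤ t * x := by nlinarith
    have h2 : cosh x ≤ cosh (t * x) := by
      rw [cosh_le_cosh, abs_of_nonneg hx, abs_of_nonneg (hx.trans h1)]; exact h1
    have h3 : sinh x ≤ sinh (t * x) := sinh_le_sinh.2 h1
    nlinarith
  · have hcosh := one_le_cosh (t * x)
    have hx1 : cosh x ≤ 1 + x * sinh x - (sinh x - x) := by
      have := exp_le_one_add_add_mul_sinh hx
      rw [← cosh_add_sinh] at this; linarith
    have hsx : x ≤ sinh x := self_le_sinh_iff.2 hx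
    -- The bracket on the right is nonnegative, so `c ≥ 1` may be replaced by 1. After `exp (t x) ≥
    -- 1 + t x` there remains `(1 - t) (sinh x - x) ≥ 0`.
    have key : t * sinh x - sinh (t * x) ≤ c * (x * sinh x - cosh x + cosh (t * x)) := by
      have h0 : 0 ≤ x * sinh x - cosh x + cosh (t * x) := by linarith
      refine le_trans ?_ (le_mul_of_one_le_left h0 hc)
      have h1 := add_one_le_exp (t * x)
      rw [← cosh_add_sinh] at h1
      nlinarith [mul_nonneg (sub_nonneg.2 h) (sub_nonneg.2 hsx)]
    have : a = t - c * x := by linarith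
    rw [this]
    linarith

open Real in
theorem cosh_add_sinh_le {c a x : ℝ} (hc : 1 ≤ c) (ha : -1 ≤ a) (ha' : a ≤ 1) :
    c * cosh x + a * sinh x ≤ c * cosh (a * x + c * x ^ 2) + sinh (a * x + c * x ^ 2) := by
  rcases le_total 0 x with h | h
  · exact cosh_add_sinh_le_of_nonneg hc ha' h
  · have := cosh_add_sinh_le_of_nonneg (c := c) (a := -a) (x := -x) hc (by linarith)
      (by linarith)
    simpa using this

open Real in
-- Keeps the resolvent denominators `R - l exp θ` and `R - l` positive. With `c = (1 + l) / (1 - l)`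
-- one has `l < 1 - 1/c ≤ exp (-1/c)` for `l > 0`, and the rest is the square `c (|x| - 1/c)² ≥ 0`.
theorem mul_exp_abs_lt {l a x : ℝ} (hl : 0 ≤ l) (hl1 : l < 1) (ha : -1 ≤ a) (ha' : a ≤ 1) :
    l * exp |x| < exp (a * x + (1 + l) / (1 - l) * x ^ 2) := by
  rcases hl.eq_or_lt with rfl | hl0
  · simp [exp_pos]
  obtain ⟨c, hc⟩ : ∃ c, c = (1 + l) / (1 - l) := ⟨_, rfl⟩
  have h1l : 0 < 1 - l := by linarith
  have hc0 : 0 < c := by rw [hc]; positivity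
  rw [← hc]
  have h1 : l < exp (-(1 / c)) := by
    refine lt_of_lt_of_le ?_ (add_one_le_exp _)
    rw [hc, one_div_div, neg_div', ← sub_pos]
    have : (-(1 - l)) / (1 + l) + 1 - l = l * (1 - l) / (1 + l) := by field_simp; ring
    rw [this]; positivity
  have h2 : -(1 / c) + |x| ≤ a * x + c * x ^ 2 := by
    have h3 : -|x| ≤ a * x := by
      have : |a * x| ≤ |x| := by
        rw [abs_mul]; exact mul_le_of_le_one_left (abs_nonneg _) (abs_le.2 ⟨ha, ha'⟩)
      linarith [neg_abs_le (a * x)]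
    have h4 : 0 ≤ c * (|x| - 1 / c) ^ 2 := by positivity
    have h5 : c * (|x| - 1 / c) ^ 2 = c * x ^ 2 - 2 * |x| + 1 / c := by
      rw [← sq_abs x]; field_simp; ring
    linarith
  calc l * exp |x| < exp (-(1 / c)) * exp |x| := by gcongr
    _ = exp (-(1 / c) + |x|) := (exp_add _ _).symm
    _ ≤ _ := exp_le_exp.2 h2

/-- The exponential bound for the moment generating function of an indicator, for the kernel
that stays put with probability `l` and otherwise jumps to the stationary distribution. -/
noncomputable def mgfBound (l p θ : ℝ) : ℝ := Real.exp (θ * p + θ ^ 2 / 4 * ((1 + l) / (1 - l)))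

theorem mgfBound_pos (l p θ : ℝ) : 0 < mgfBound l p θ := Real.exp_pos _

open Real in
theorem mgfBound_eq (l p θ : ℝ) : mgfBound l p θ =
    exp (θ / 2) * exp ((2 * p - 1) * (θ / 2) + (1 + l) / (1 - l) * (θ / 2) ^ 2) := by
  rw [mgfBound, ← exp_add]; congr 1; ring

open Real in
theorem mul_exp_lt_mgfBound {l p θ : ℝ} (hl : 0 ≤ l) (hl1 : l < 1) (hp : 0 ≤ p) (hp1 : p ≤ 1) :
    l * exp θ < mgfBound l p θ := by
  have h := mul_exp_abs_lt (a := 2 * p - 1) (x := θ / 2) hl hl1 (by linarith) (by linarith)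
  rw [mgfBound_eq]
  calc l * exp θ = exp (θ / 2) * (l * exp (θ / 2)) := by
        rw [show θ = θ / 2 + θ / 2 by ring, exp_add]; ring_nf
    _ ≤ exp (θ / 2) * (l * exp |θ / 2|) := by gcongr; exact le_abs_self _
    _ < _ := by gcongr

open Real in
theorem lt_mgfBound {l p θ : ℝ} (hl : 0 ≤ l) (hl1 : l < 1) (hp : 0 ≤ p) (hp1 : p ≤ 1) :
    l < mgfBound l p θ := by
  have h := mul_exp_abs_lt (a := 2 * p - 1) (x := θ / 2) hl hl1 (by linarith) (by linarith)
  rw [mgfBound_eq]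
  calc l = exp (θ / 2) * (l * exp (-(θ / 2))) := by
        rw [mul_left_comm, ← exp_add]; simp
    _ ≤ exp (θ / 2) * (l * exp |θ / 2|) := by gcongr; exact neg_le_abs _
    _ < _ := by gcongr

open Real in
theorem resolvent_le_one {l p θ : ℝ} (hl : 0 ≤ l) (hl1 : l < 1) (hp : 0 ≤ p) (hp1 : p ≤ 1) :
    (1 - l) * (p * (exp θ / (mgfBound l p θ - l * exp θ))
      + (1 - p) * (1 / (mgfBound l p θ - l))) ≤ 1 := by
  have h1 : 0 < mgfBound l p θ - l * exp θ := sub_pos.2 (mul_exp_lt_mgfBound hl hl1 hp hp1)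
  have h2 : 0 < mgfBound l p θ - l := sub_pos.2 (lt_mgfBound hl hl1 hp hp1)
  have h1l : 0 < 1 - l := by linarith
  have hc : 1 ≤ (1 + l) / (1 - l) := by rw [one_le_div h1l]; linarith
  have key := cosh_add_sinh_le (c := (1 + l) / (1 - l)) (a := 2 * p - 1) (x := θ / 2) hc
    (by linarith) (by linarith)
  have hR := mgfBound_eq l p θ
  set y := (2 * p - 1) * (θ / 2) + (1 + l) / (1 - l) * (θ / 2) ^ 2
  have hE : exp θ = exp (θ / 2) ^ 2 := by rw [sq, ← exp_add]; ring_nf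
  set R := mgfBound l p θ
  rw [div_mul_eq_mul_div, div_mul_eq_mul_div, ← sub_nonneg] at key
  simp only [cosh_eq, sinh_eq, exp_neg] at key
  have hA : 0 < exp (θ / 2) := exp_pos _
  have hY : 0 < exp y := exp_pos _
  -- The characteristic polynomial, at `R`, of the two-state chain with kernel `l id + (1 - l) π`
  -- tilted by `exp θ` on the state of mass `p`.
  have key2 : 0 ≤ R ^ 2 - R * (l * (1 + exp θ) + (1 - l) * (p * exp θ + (1 - p))) + l * exp θ := by
    have := mul_nonneg (mul_nonneg key h1l.le) (mul_pos (pow_pos hA 2) hY).le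
    refine this.trans_eq ?_
    rw [hE, hR]
    field_simp
    ring
  rw [mul_div_assoc', mul_div_assoc', div_add_div _ _ h1.ne' h2.ne', mul_div_assoc',
    div_le_one (mul_pos h1 h2)]
  linarith

/-! ### Symmetric operators on a real Hilbert space -/

section Hilbert

variable {H : Type*} [NormedAddCommGroup H] [InnerProductSpace ℝ H]

/-- The norm of a symmetric operator is the supremum of the absolute Rayleigh quotients. Were `‖S‖`
in the resolvent set, these quotients, being nonnegative, would stay below `‖S‖ - ε`. -/
theorem norm_mem_spectrum_of_inner_nonneg [Nontrivial H] {S : H →L[ℝ] H}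
    (hS : (S : H →ₗ[ℝ] H).IsSymmetric)
    (hpos : ∀ x, 0 ≤ inner ℝ (S x) x) : ‖S‖ ∈ spectrum ℝ S := by
  by_contra h
  obtain ⟨ε, hε, h1⟩ := S.rayleighQuotient_le_of_norm_mem_resolventSet (𝕜 := ℝ)
    (by simpa [spectrum] using h)
  have h2 := S.norm_eq_iSup_rayleighQuotient hS
  have h3 : ∀ x, |S.rayleighQuotient x| ≤ ‖S‖ - ε := by
    intro x
    rw [abs_of_nonneg]
    · exact h1 x
    · exact div_nonneg (by simpa [ContinuousLinearMap.reApplyInnerSelf] using hpos x) (sq_nonneg _)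
  have h4 := ciSup_le h3
  linarith

/-- The quadratic form of a symmetric operator on a real Hilbert space is bounded by the top of
its spectrum. -/
theorem inner_le_sSup_spectrum [CompleteSpace H] {T : H →L[ℝ] H}
    (hT : (T : H →ₗ[ℝ] H).IsSymmetric) (f : H) :
    inner ℝ (T f) f ≤ sSup (spectrum ℝ T) * ‖f‖ ^ 2 := by
  rcases subsingleton_or_nontrivial H with hH | hH
  · simp [Subsingleton.elim f 0]
  -- Shifting by `‖T‖` makes the form nonnegative, so the norm of the shift is a spectral value and
  -- shifts back to one of `T`.
  set S : H →L[ℝ] H := T + algebraMap ℝ (H →L[ℝ] H) ‖T‖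
  have hSa : ∀ x, S x = T x + ‖T‖ • x := fun x => by
    simp [S, Algebra.algebraMap_eq_smul_one]
  have hS : (S : H →ₗ[ℝ] H).IsSymmetric := by
    intro x y
    have := hT x y
    simp only [ContinuousLinearMap.coe_coe] at this ⊢
    rw [hSa, hSa, inner_add_left, inner_add_right, this, inner_smul_left, inner_smul_right]
    simp
  have hpos : ∀ x, 0 ≤ inner ℝ (S x) x := by
    intro x
    rw [hSa, inner_add_left, inner_smul_left, real_inner_self_eq_norm_sq]
    have h1 := abs_real_inner_le_norm (T x) x
    have h2 := mul_le_mul_of_nonneg_right (T.le_opNorm x) (norm_nonneg x)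
    have h3 := neg_abs_le (inner ℝ (T x) x)
    simp only [conj_trivial]
    nlinarith
  have hmem := norm_mem_spectrum_of_inner_nonneg hS hpos
  have hmem' : ‖S‖ - ‖T‖ ∈ spectrum ℝ T := by
    have := (spectrum.add_mem_add_iff (R := ℝ) (a := T) (r := ‖S‖ - ‖T‖) (s := ‖T‖)).1
      (by simpa [S, add_comm] using hmem)
    exact this
  have hle := le_csSup (spectrum.isCompact (𝕜 := ℝ) T).bddAbove hmem'
  have h5 : inner ℝ (S f) f ≤ ‖S‖ * ‖f‖ ^ 2 := by
    have h1 := real_inner_le_norm (S f) f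
    have h2 := mul_le_mul_of_nonneg_right (S.le_opNorm f) (norm_nonneg f)
    nlinarith
  rw [hSa, inner_add_left, inner_smul_left, real_inner_self_eq_norm_sq] at h5
  simp only [conj_trivial] at h5
  nlinarith [sq_nonneg ‖f‖]

/-- For `μ ≤ 0` and at least one term, the left sum is `(1 - μⁿ) / (1 - μ)`, which lies in `[0, 1]`,
while the right sum is at least its term for `k = 0`. Single powers do not compare, since `|μ|` may
exceed `l`. -/
theorem abs_geom_sum_le {l μ : ℝ} (hμ : -1 ≤ μ) (hμl : μ ≤ l) (hl : 0 ≤ l) (n : ℕ) :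
    |∑ k ∈ Finset.range n, μ ^ k| ≤ ∑ k ∈ Finset.range n, l ^ k := by
  rcases le_total 0 μ with h | h
  · rw [abs_of_nonneg (Finset.sum_nonneg fun k _ => pow_nonneg h k)]
    gcongr
  · rcases n with _ | n
    · simp
    have h1 : (1 : ℝ) ≤ ∑ k ∈ Finset.range (n + 1), l ^ k := by
      rw [Finset.sum_range_succ']
      simpa using Finset.sum_nonneg fun k _ => pow_nonneg hl (k + 1)
    refine le_trans ?_ h1
    have hμ1 : 0 < 1 - μ := by linarith
    have h2 : (∑ k ∈ Finset.range (n + 1), μ ^ k) * (1 - μ) = 1 - μ ^ (n + 1) := by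
      rw [← neg_sub, ← neg_sub (μ ^ (n + 1)), mul_neg, geom_sum_mul]
    have h3 : |μ ^ (n + 1)| ≤ -μ := by
      rw [abs_pow, abs_of_nonpos h, pow_succ]
      exact mul_le_of_le_one_left (by linarith) (pow_le_one₀ (by linarith) (by linarith))
    have h4 := abs_le.1 h3
    rw [abs_le]
    constructor <;> nlinarith

theorem norm_sum_pow_apply_le_finiteDimensional [FiniteDimensional ℝ H] {A : H →ₗ[ℝ] H}
    (hA : A.IsSymmetric) {l : ℝ} (hl : 0 ≤ l) (hlow : ∀ f, -(‖f‖ ^ 2) ≤ inner ℝ (A f) f)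
    (hup : ∀ f, inner ℝ (A f) f ≤ l * ‖f‖ ^ 2) (n : ℕ) (f : H) :
    ‖∑ k ∈ Finset.range n, (A ^ k) f‖ ≤ (∑ k ∈ Finset.range n, l ^ k) * ‖f‖ := by
  let b := hA.eigenvectorBasis rfl
  let μ := hA.eigenvalues rfl
  have hb : ∀ i, A (b i) = μ i • b i := fun i => by
    exact hA.apply_eigenvectorBasis rfl i
  have hμ : ∀ i, inner ℝ (A (b i)) (b i) = μ i := fun i => by
    rw [hb, inner_smul_left, real_inner_self_eq_norm_sq]; simp
  have hcoef : ∀ k i g, inner ℝ (b i) ((A ^ k) g) = μ i ^ k * inner ℝ (b i) g := by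
    intro k
    induction k with
    | zero => intro i g; simp
    | succ k ih =>
      intro i g
      rw [pow_succ', Module.End.mul_apply, ← hA, hb, inner_smul_left, ih]
      simp [pow_succ']
      ring
  have hc0 : 0 ≤ ∑ k ∈ Finset.range n, l ^ k := Finset.sum_nonneg fun k _ => pow_nonneg hl k
  rw [← sq_le_sq₀ (norm_nonneg _) (by positivity), mul_pow, ← b.sum_sq_norm_inner_right,
    ← b.sum_sq_norm_inner_right f, Finset.mul_sum]
  refine Finset.sum_le_sum fun i _ => ?_
  rw [inner_sum]
  simp_rw [hcoef]
  rw [← Finset.sum_mul, norm_mul, mul_pow]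
  gcongr
  have h1 := hlow (b i)
  have h2 := hup (b i)
  rw [hμ] at h1 h2
  simp at h1 h2
  exact abs_geom_sum_le h1 h2 hl n

theorem norm_sum_pow_apply_le {T : H →L[ℝ] H} (hT : (T : H →ₗ[ℝ] H).IsSymmetric)
    {l : ℝ} (hl : 0 ≤ l) (hlow : ∀ f, -(‖f‖ ^ 2) ≤ inner ℝ (T f) f)
    (hup : ∀ f, inner ℝ (T f) f ≤ l * ‖f‖ ^ 2) (n : ℕ) (f : H) :
    ‖∑ k ∈ Finset.range n, (T ^ k) f‖ ≤ (∑ k ∈ Finset.range n, l ^ k) * ‖f‖ := by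
  -- Compression to the Krylov space of `f` preserves symmetry and both form bounds, and leaves `T ^
  -- k f` unchanged for `k ≤ n`; the finite-dimensional spectral theorem then suffices.
  let V : Submodule ℝ H := Submodule.span ℝ (Set.range fun k : Fin (n + 1) => (T ^ (k : ℕ)) f)
  have hmem : ∀ k ≤ n, (T ^ k) f ∈ V := fun k hk =>
    Submodule.subset_span ⟨⟨k, by omega⟩, rfl⟩
  have : FiniteDimensional ℝ V := FiniteDimensional.span_of_finite ℝ (Set.finite_range _)
  let A : V →ₗ[ℝ] V :=
    (V.orthogonalProjectionOnto : H →ₗ[ℝ] V) ∘ₗ (T : H →ₗ[ℝ] H) ∘ₗ V.subtype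
  have hAin : ∀ x y : V, inner ℝ (A x) y = inner ℝ (T x) (y : H) := fun x y => by
    change inner ℝ (V.orthogonalProjectionOnto (T x)) y = _
    rw [Submodule.inner_orthogonalProjectionOnto_eq_of_mem_right]
  have hAsymm : A.IsSymmetric := by
    intro x y
    rw [hAin, real_inner_comm (A y) x, hAin, ← real_inner_comm _ (x : H)]
    exact hT x y
  let f' : V := ⟨f, by simpa using hmem 0 (by omega)⟩
  have hpow : ∀ k ≤ n, ((A ^ k) f' : H) = (T ^ k) f := by
    intro k
    induction k with
    | zero => intro _; simp [f']
    | succ k ih =>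
      intro hk
      rw [pow_succ', Module.End.mul_apply]
      change ((V.orthogonalProjectionOnto (T ((A ^ k) f' : V)) : V) : H) = _
      rw [ih (by omega), pow_succ', mul_apply_eq_comp]
      have := hmem (k + 1) hk
      rw [pow_succ', mul_apply_eq_comp] at this
      exact congrArg Subtype.val
        (Submodule.orthogonalProjectionOnto_mem_subspace_eq_self (K := V) ⟨_, this⟩)
  have := norm_sum_pow_apply_le_finiteDimensional hAsymm hl
    (fun g => by rw [hAin]; exact hlow g) (fun g => by rw [hAin]; exact hup g) n f'
  refine le_trans (le_of_eq ?_) this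
  rw [Submodule.coe_norm, Submodule.coe_sum]
  congr 1
  exact Finset.sum_congr rfl fun k hk => (hpow k (by simp at hk; omega)).symm

end Hilbert

/-! ### The bilinear form of a reversible kernel on `L₂(π)` -/

section Form

variable {α : Type*} [MeasurableSpace α] {K : Kernel α α} {π : Measure α}

/-- Reversibility is this symmetry tested on rectangles, which determine the measure. -/
theorem compProd_map_swap [IsMarkovKernel K] [IsProbabilityMeasure π] (hK : K.IsReversible π) :
    (π ⊗ₘ K).map Prod.swap = π ⊗ₘ K := by
  refine Measure.ext_prod fun {A B} hA hB => ?_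
  rw [Measure.map_apply measurable_swap (hA.prod hB), Set.preimage_swap_prod,
    Measure.compProd_apply_prod hB hA, Measure.compProd_apply_prod hA hB]
  exact hK hB hA

theorem measurePreserving_fst_compProd [IsMarkovKernel K] [IsProbabilityMeasure π] :
    MeasurePreserving Prod.fst (π ⊗ₘ K) π :=
  ⟨measurable_fst, Measure.fst_compProd π K⟩

theorem measurePreserving_snd_compProd [IsMarkovKernel K] [IsProbabilityMeasure π]
    (hK : K.Invariant π) : MeasurePreserving Prod.snd (π ⊗ₘ K) π :=
  ⟨measurable_snd, by rw [← Measure.snd, Measure.snd_compProd, hK.def]⟩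

theorem integral_comp_measurePreserving {β : Type*} [MeasurableSpace β] {ρ : Measure β}
    {p : β → α} (hp : MeasurePreserving p ρ π) {g : α → ℝ} (hg : AEStronglyMeasurable g π) :
    ∫ z, g (p z) ∂ρ = ∫ x, g x ∂π := by
  rw [← hp.map_eq] at hg ⊢
  exact (integral_map hp.aemeasurable hg).symm

/-- The bilinear form of a Markov operator. -/
noncomputable def markovForm (K : Kernel α α) (π : Measure α) (g h : α → ℝ) : ℝ :=
  ∫ z, g z.1 * h z.2 ∂(π ⊗ₘ K)

theorem markovForm_smul_left (c : ℝ) (g h : α → ℝ) :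
    markovForm K π (c • g) h = c * markovForm K π g h := by
  simp only [markovForm, Pi.smul_apply, smul_eq_mul, mul_assoc]
  exact integral_const_mul _ _

variable [IsMarkovKernel K] [IsProbabilityMeasure π]

theorem integrable_markovForm (hK : K.Invariant π) {g h : α → ℝ} (hg : MemLp g 2 π)
    (hh : MemLp h 2 π) : Integrable (fun z : α × α => g z.1 * h z.2) (π ⊗ₘ K) :=
  (hg.comp_measurePreserving measurePreserving_fst_compProd).integrable_mul
    (hh.comp_measurePreserving (measurePreserving_snd_compProd hK))

theorem markovForm_eq (hK : K.Invariant π) {g h : α → ℝ} (hg : MemLp g 2 π)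
    (hh : MemLp h 2 π) : markovForm K π g h = ∫ x, g x * ∫ y, h y ∂(K x) ∂π := by
  rw [markovForm, Measure.integral_compProd (integrable_markovForm hK hg hh)]
  simp_rw [integral_const_mul]

theorem markovForm_comm (hK : K.IsReversible π) (g h : α → ℝ) :
    markovForm K π g h = markovForm K π h g := by
  have hmp : MeasurePreserving (MeasurableEquiv.prodComm (α := α) (β := α)) (π ⊗ₘ K) (π ⊗ₘ K) :=
    ⟨measurable_swap, compProd_map_swap hK⟩
  rw [markovForm, ← hmp.integral_comp', markovForm]
  refine integral_congr_ae (Filter.Eventually.of_forall fun z => ?_)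
  exact mul_comm _ _

theorem markovForm_add_left (hK : K.Invariant π) {g g' h : α → ℝ} (hg : MemLp g 2 π)
    (hg' : MemLp g' 2 π) (hh : MemLp h 2 π) :
    markovForm K π (g + g') h = markovForm K π g h + markovForm K π g' h := by
  simp only [markovForm, Pi.add_apply, add_mul]
  exact integral_add (integrable_markovForm hK hg hh) (integrable_markovForm hK hg' hh)

theorem inner_markovOperator (hK : K.Invariant π) (f g : Lp ℝ 2 π) :
    inner ℝ (markovOperator K π hK f) g = markovForm K π g f := by
  rw [markovForm_eq hK (Lp.memLp g) (Lp.memLp f), L2.inner_def]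
  refine integral_congr_ae ?_
  filter_upwards [markovOperator_coeFn hK f] with x hx
  rw [hx]
  simp

theorem isSymmetric_markovOperatorZero (hK : K.IsReversible π) :
    (markovOperatorZero K π hK.invariant : L2Zero π →ₗ[ℝ] L2Zero π).IsSymmetric := by
  intro f g
  change inner ℝ (markovOperator K π hK.invariant f) (g : Lp ℝ 2 π)
    = inner ℝ (f : Lp ℝ 2 π) (markovOperator K π hK.invariant g)
  rw [inner_markovOperator, ← real_inner_comm, inner_markovOperator, markovForm_comm hK]

theorem norm_markovOperator_apply_le (hK : K.Invariant π) (f : Lp ℝ 2 π) :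
    ‖markovOperator K π hK f‖ ≤ ‖f‖ := by
  refine ((markovOperator K π hK).le_opNorm f).trans
    (mul_le_of_le_one_left (norm_nonneg _) ?_)
  exact LinearMap.mkContinuous_norm_le _ zero_le_one _

theorem neg_norm_sq_le_inner_markovOperatorZero (hK : K.Invariant π) (f : L2Zero π) :
    -(‖f‖ ^ 2) ≤ inner ℝ (markovOperatorZero K π hK f) f := by
  have h1 := neg_abs_le (inner ℝ (markovOperatorZero K π hK f) f)
  have h2 := abs_real_inner_le_norm (markovOperatorZero K π hK f) f
  have h3 : ‖markovOperatorZero K π hK f‖ ≤ ‖f‖ :=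
    norm_markovOperator_apply_le hK (f : Lp ℝ 2 π)
  nlinarith [norm_nonneg f]

/-- `L₂⁰(π)` is the orthogonal complement of the constants, hence closed. -/
theorem isClosed_L2Zero : IsClosed (L2Zero π : Set (Lp ℝ 2 π)) := by
  let one2 : Lp ℝ 2 π := (memLp_const (1 : ℝ)).toLp (fun _ => (1 : ℝ))
  have h : (L2Zero π : Set (Lp ℝ 2 π))
      = {f | inner ℝ (one2 : Lp ℝ 2 π) f = (0 : ℝ)} := by
    ext f
    change ∫ x, f x ∂π = 0 ↔ inner ℝ (one2 : Lp ℝ 2 π) f = 0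
    rw [L2.inner_def]
    have : ∫ x, inner ℝ (one2 x) (f x) ∂π
        = ∫ x, f x ∂π := by
      refine integral_congr_ae ?_
      filter_upwards [MemLp.coeFn_toLp (memLp_const (1 : ℝ) (μ := π) (p := 2))] with x hx
      rw [hx]; simp
    rw [this]
  rw [h]
  exact isClosed_eq (by fun_prop) (by fun_prop)

instance : CompleteSpace (L2Zero π) := isClosed_L2Zero.completeSpace_coe

theorem inner_markovOperatorZero_le (hK : K.IsReversible π) (f : L2Zero π) :
    inner ℝ (markovOperatorZero K π hK.invariant f) f ≤ specSup₀ K π hK * ‖f‖ ^ 2 :=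
  (inner_le_sSup_spectrum (isSymmetric_markovOperatorZero hK) f).trans
    (by gcongr; exact le_max_right _ _)

theorem memLp_centered {g : α → ℝ} (hg : MemLp g 2 π) :
    MemLp (fun x => g x - ∫ y, g y ∂π) 2 π := hg.sub (memLp_const _)

/-- The centered version of a square integrable function, as an element of `L₂⁰`. -/
noncomputable def centered {g : α → ℝ} (hg : MemLp g 2 π) : L2Zero π :=
  ⟨(memLp_centered hg).toLp _, by
    change ∫ x, (memLp_centered hg).toLp _ x ∂π = 0
    rw [integral_congr_ae (memLp_centered hg).coeFn_toLp,
      integral_sub (hg.integrable (by norm_num)) (integrable_const _)]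
    simp⟩

theorem norm_centered_sq {g : α → ℝ} (hg : MemLp g 2 π) :
    ‖centered hg‖ ^ 2 = ∫ x, g x ^ 2 ∂π - (∫ x, g x ∂π) ^ 2 := by
  rw [Submodule.coe_norm, ← real_inner_self_eq_norm_sq, L2.inner_def]
  have h1 : Integrable g π := hg.integrable (by norm_num)
  have h2 : Integrable (fun x => g x ^ 2) π := hg.integrable_sq
  set m := ∫ x, g x ∂π with hm
  have : ∫ x, inner ℝ ((centered hg : Lp ℝ 2 π) x) ((centered hg : Lp ℝ 2 π) x) ∂π
      = ∫ x, (g x ^ 2 - (2 * m) * g x + m ^ 2) ∂π := by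
    refine integral_congr_ae ?_
    filter_upwards [(memLp_centered hg).coeFn_toLp] with x hx
    change inner ℝ ((memLp_centered hg).toLp _ x) ((memLp_centered hg).toLp _ x) = _
    rw [hx]
    simp [← hm]
    ring
  have h3 : Integrable (fun x => g x ^ 2 - (2 * m) * g x) π := h2.sub (h1.const_mul _)
  rw [this, integral_add h3 (integrable_const _),
    integral_sub h2 (h1.const_mul _), integral_const_mul]
  simp [← hm]
  ring

/-- The quadratic form of `K` is dominated by the one of `l • id + (1 - l) • π`, where
`l = Λ₀`. -/
theorem markovForm_self_le (hK : K.IsReversible π) {g : α → ℝ} (hg : MemLp g 2 π) :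
    markovForm K π g g ≤ specSup₀ K π hK * ∫ x, g x ^ 2 ∂π
      + (1 - specSup₀ K π hK) * (∫ x, g x ∂π) ^ 2 := by
  have h1 := inner_markovOperatorZero_le hK (centered hg)
  have h2 : inner ℝ (markovOperatorZero K π hK.invariant (centered hg)) (centered hg)
      = markovForm K π g g - (∫ x, g x ∂π) ^ 2 := by
    change inner ℝ (markovOperator K π hK.invariant (centered hg)) (centered hg : Lp ℝ 2 π) = _
    rw [inner_markovOperator]
    set m := ∫ x, g x ∂π with hm
    have e1 := (measurePreserving_fst_compProd (K := K) (π := π)).quasiMeasurePreserving.ae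
      (memLp_centered hg).coeFn_toLp
    have e2 := (measurePreserving_snd_compProd hK.invariant).quasiMeasurePreserving.ae
      (memLp_centered hg).coeFn_toLp
    have i1 : Integrable (fun z : α × α => g z.1) (π ⊗ₘ K) :=
      measurePreserving_fst_compProd.integrable_comp_of_integrable (hg.integrable (by norm_num))
    have i2 : Integrable (fun z : α × α => g z.2) (π ⊗ₘ K) :=
      (measurePreserving_snd_compProd hK.invariant).integrable_comp_of_integrable
        (hg.integrable (by norm_num))
    have i3 := integrable_markovForm hK.invariant hg hg
    have j1 : ∫ z : α × α, g z.1 ∂(π ⊗ₘ K) = m :=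
      integral_comp_measurePreserving measurePreserving_fst_compProd hg.1
    have j2 : ∫ z : α × α, g z.2 ∂(π ⊗ₘ K) = m :=
      integral_comp_measurePreserving (measurePreserving_snd_compProd hK.invariant) hg.1
    have : markovForm K π (centered hg : Lp ℝ 2 π) (centered hg : Lp ℝ 2 π)
        = ∫ z : α × α, (g z.1 * g z.2 - m * g z.1 - m * g z.2 + m ^ 2) ∂(π ⊗ₘ K) := by
      refine integral_congr_ae ?_
      filter_upwards [e1, e2] with z h1 h2
      change (memLp_centered hg).toLp _ z.1 * (memLp_centered hg).toLp _ z.2 = _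
      rw [h1, h2, ← hm]
      ring
    have k1 : Integrable (fun z : α × α => g z.1 * g z.2 - m * g z.1) (π ⊗ₘ K) :=
      i3.sub (i1.const_mul _)
    have k2 : Integrable (fun z : α × α => g z.1 * g z.2 - m * g z.1 - m * g z.2) (π ⊗ₘ K) :=
      k1.sub (i2.const_mul _)
    rw [this, integral_add k2 (integrable_const _), integral_sub k1 (i2.const_mul _),
      integral_sub i3 (i1.const_mul _), integral_const_mul, integral_const_mul, j1, j2, markovForm]
    simp
    ring
  rw [h2, norm_centered_sq] at h1
  linarith

end Form

/-! ### Bounded measurable functions, a class stable under products and kernel means -/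

section Bounded

variable {α : Type*} [MeasurableSpace α]

/-- Bounded measurable real functions. -/
structure BddMeas (g : α → ℝ) : Prop where
  measurable : Measurable g
  bound : ∃ C, ∀ x, |g x| ≤ C

namespace BddMeas

theorem const (c : ℝ) : BddMeas (fun _ : α => c) := ⟨measurable_const, |c|, fun _ => le_rfl⟩

theorem add {g h : α → ℝ} (hg : BddMeas g) (hh : BddMeas h) : BddMeas (g + h) := by
  obtain ⟨C, hC⟩ := hg.bound
  obtain ⟨D, hD⟩ := hh.bound
  exact ⟨hg.measurable.add hh.measurable, C + D, fun x =>
    (abs_add_le _ _).trans (add_le_add (hC x) (hD x))⟩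

theorem mul {g h : α → ℝ} (hg : BddMeas g) (hh : BddMeas h) : BddMeas (fun x => g x * h x) := by
  obtain ⟨C, hC⟩ := hg.bound
  obtain ⟨D, hD⟩ := hh.bound
  refine ⟨hg.measurable.mul hh.measurable, C * D, fun x => ?_⟩
  rw [abs_mul]
  exact mul_le_mul (hC x) (hD x) (abs_nonneg _) ((abs_nonneg _).trans (hC x))

theorem smul {g : α → ℝ} (c : ℝ) (hg : BddMeas g) : BddMeas (c • g) := (const c).mul hg

theorem abs {g : α → ℝ} (hg : BddMeas g) : BddMeas (fun x => |g x|) := by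
  obtain ⟨C, hC⟩ := hg.bound
  exact ⟨hg.measurable.abs, C, fun x => by simpa using hC x⟩

theorem memLp {g : α → ℝ} (hg : BddMeas g) (p : ℝ≥0∞) (μ : Measure α) [IsFiniteMeasure μ] :
    MemLp g p μ := by
  obtain ⟨C, hC⟩ := hg.bound
  exact MemLp.of_bound hg.measurable.aestronglyMeasurable C
    (Filter.Eventually.of_forall fun x => by simpa using hC x)

theorem integrable {g : α → ℝ} (hg : BddMeas g) (μ : Measure α) [IsFiniteMeasure μ] :
    Integrable g μ := memLp_one_iff_integrable.1 (hg.memLp 1 μ)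

theorem kernelMean {g : α → ℝ} (hg : BddMeas g) (K : Kernel α α) [IsMarkovKernel K] :
    BddMeas (fun x => ∫ y, g y ∂(K x)) := by
  obtain ⟨C, hC⟩ := hg.bound
  refine ⟨(hg.measurable.stronglyMeasurable.integral_kernel).measurable, C, fun x => ?_⟩
  have := norm_integral_le_of_norm_le_const (μ := K x) (C := C) (f := g)
    (Filter.Eventually.of_forall fun y => by simpa using hC y)
  simpa using this

end BddMeas

end Bounded

/-! ### Moment generating function of occupation times -/

section Moment

/-- The function `exp (θ 1_A)`. -/
noncomputable def tilt {α : Type*} (θ : ℝ) (A : Set α) (x : α) : ℝ :=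
  Real.exp (θ * A.indicator (fun _ => (1 : ℝ)) x)

theorem tilt_pos {α : Type*} (θ : ℝ) (A : Set α) (x : α) : 0 < tilt θ A x := Real.exp_pos _

theorem tilt_half_mul_self {α : Type*} (θ : ℝ) (A : Set α) (x : α) :
    tilt (θ / 2) A x * tilt (θ / 2) A x = tilt θ A x := by
  rw [tilt, tilt, ← Real.exp_add]; congr 1; ring

theorem tilt_of_mem {α : Type*} {θ : ℝ} {A : Set α} {x : α} (hx : x ∈ A) : tilt θ A x = Real.exp θ := by
  simp [tilt, hx]

theorem tilt_of_notMem {α : Type*} {θ : ℝ} {A : Set α} {x : α} (hx : x ∉ A) : tilt θ A x = 1 := by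
  simp [tilt, hx]

variable {α : Type*} [MeasurableSpace α] {K : Kernel α α} {π : Measure α}

theorem bddMeas_tilt (θ : ℝ) {A : Set α} (hA : MeasurableSet A) : BddMeas (tilt θ A) := by
  refine ⟨by unfold tilt; fun_prop (disch := assumption), max (Real.exp θ) 1, fun x => ?_⟩
  rw [abs_of_pos (tilt_pos θ A x)]
  by_cases hx : x ∈ A
  · rw [tilt_of_mem hx]; exact le_max_left _ _
  · rw [tilt_of_notMem hx]; exact le_max_right _ _

theorem integral_comp_tilt [IsProbabilityMeasure π] (θ : ℝ) {A : Set α} (hA : MeasurableSet A)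
    (F : ℝ → ℝ) :
    ∫ x, F (tilt θ A x) ∂π = π.real A * F (Real.exp θ) + (1 - π.real A) * F 1 := by
  have h : ∀ x, F (tilt θ A x) = A.indicator (fun _ => F (Real.exp θ)) x
      + Aᶜ.indicator (fun _ => F 1) x := by
    intro x
    by_cases hx : x ∈ A
    · simp [tilt_of_mem hx, hx]
    · simp [tilt_of_notMem hx, hx]
  simp_rw [h]
  rw [integral_add ((integrable_const _).indicator hA) ((integrable_const _).indicator hA.compl),
    integral_indicator_const _ hA, integral_indicator_const _ hA.compl, probReal_compl_eq_one_sub hA]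
  simp

/-- The case `l = 0` of the resolvent inequality is a Hoeffding lemma for one indicator, and
`mgfBound` increases with `l`. -/
theorem integral_tilt_le [IsProbabilityMeasure π] {l : ℝ} (hl : 0 ≤ l) (hl1 : l < 1) (θ : ℝ)
    {A : Set α} (hA : MeasurableSet A) : ∫ x, tilt θ A x ∂π ≤ mgfBound l (π.real A) θ := by
  have h := resolvent_le_one (l := 0) (p := π.real A) (θ := θ) le_rfl one_pos measureReal_nonneg
    measureReal_le_one
  have h0 := mgfBound_pos 0 (π.real A) θ
  rw [integral_comp_tilt θ hA (fun t => t)]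
  simp only [sub_zero, zero_mul, one_mul, mul_div_assoc', ← add_div] at h
  rw [div_le_one h0] at h
  refine h.trans (Real.exp_le_exp.2 ?_)
  have : (1 + 0) / (1 - 0) ≤ (1 + l) / (1 - l) := by
    rw [le_div_iff₀ (by linarith)]; linarith
  gcongr

/-- With `w = R - l m²` and `I = ∫ m g`, integrate `2 (1 - l) I m g ≤ w g² + (1 - l)² I² m² / w`.
The last term integrates to at most `(1 - l) I²` by `resolvent_le_one`. -/
theorem quadratic_tilt_le [IsProbabilityMeasure π] {l : ℝ} (hl : 0 ≤ l) (hl1 : l < 1) (θ : ℝ)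
    {A : Set α} (hA : MeasurableSet A) {g : α → ℝ} (hg : BddMeas g) :
    l * ∫ x, (tilt (θ / 2) A x * g x) ^ 2 ∂π + (1 - l) * (∫ x, tilt (θ / 2) A x * g x ∂π) ^ 2
      ≤ mgfBound l (π.real A) θ * ∫ x, g x ^ 2 ∂π := by
  set R := mgfBound l (π.real A) θ with hR
  have hw : ∀ x, 0 < R - l * tilt θ A x := by
    intro x
    by_cases hx : x ∈ A
    · rw [tilt_of_mem hx]
      exact sub_pos.2 (mul_exp_lt_mgfBound hl hl1 measureReal_nonneg measureReal_le_one)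
    · rw [tilt_of_notMem hx, mul_one]
      exact sub_pos.2 (lt_mgfBound hl hl1 measureReal_nonneg measureReal_le_one)
  set τ := ∫ x, tilt θ A x / (R - l * tilt θ A x) ∂π with hτ
  have hτ1 : (1 - l) * τ ≤ 1 := by
    rw [hτ, integral_comp_tilt θ hA (fun t => t / (R - l * t)), mul_one]
    exact resolvent_le_one hl hl1 measureReal_nonneg measureReal_le_one
  have hmg : BddMeas (fun x => tilt (θ / 2) A x * g x) := (bddMeas_tilt _ hA).mul hg
  set I := ∫ x, tilt (θ / 2) A x * g x ∂π with hI
  have i1 : Integrable (fun x => (tilt (θ / 2) A x * g x) ^ 2) π := (hmg.memLp 2 π).integrable_sq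
  have i2 : Integrable (fun x => g x ^ 2) π := (hg.memLp 2 π).integrable_sq
  have i3 : Integrable (fun x => tilt θ A x / (R - l * tilt θ A x)) π := by
    have h : ∀ x, tilt θ A x / (R - l * tilt θ A x)
        = A.indicator (fun _ => Real.exp θ / (R - l * Real.exp θ)) x
          + Aᶜ.indicator (fun _ => 1 / (R - l * 1)) x := by
      intro x
      by_cases hx : x ∈ A
      · simp [tilt_of_mem hx, hx]
      · simp [tilt_of_notMem hx, hx]
    simp_rw [h]
    exact ((integrable_const _).indicator hA).add ((integrable_const _).indicator hA.compl)
  have i4 : Integrable (fun x => (1 - l) ^ 2 * I ^ 2 * (tilt θ A x / (R - l * tilt θ A x))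
      + (R * g x ^ 2 - l * (tilt (θ / 2) A x * g x) ^ 2)) π :=
    (i3.const_mul _).add ((i2.const_mul _).sub (i1.const_mul _))
  have key : ∫ x, 2 * ((1 - l) * I) * (tilt (θ / 2) A x * g x) ∂π
      ≤ ∫ x, ((1 - l) ^ 2 * I ^ 2 * (tilt θ A x / (R - l * tilt θ A x))
        + (R * g x ^ 2 - l * (tilt (θ / 2) A x * g x) ^ 2)) ∂π := by
    refine integral_mono ((hmg.integrable π).const_mul _) i4 fun x => ?_
    have hx := hw x
    have e := tilt_half_mul_self θ A x
    simp only
    generalize tilt (θ / 2) A x = m at e ⊢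
    rw [← e] at hx ⊢
    rw [← sub_nonneg]
    obtain ⟨w, hwx⟩ : ∃ w, w = R - l * (m * m) := ⟨_, rfl⟩
    have hRw : R = w + l * (m * m) := by rw [hwx]; ring
    rw [← hwx] at hx ⊢
    have : 0 ≤ ((1 - l) * I * m - w * g x) ^ 2 / w := by positivity
    refine this.trans_eq ?_
    field_simp
    rw [hRw]
    ring
  have i5 : Integrable (fun x => R * g x ^ 2 - l * (tilt (θ / 2) A x * g x) ^ 2) π :=
    (i2.const_mul _).sub (i1.const_mul _)
  rw [integral_const_mul, integral_add (i3.const_mul _) i5,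
    integral_sub (i2.const_mul _) (i1.const_mul _), integral_const_mul, integral_const_mul,
    integral_const_mul, ← hτ, ← hI] at key
  have h1 : (1 - l) ^ 2 * I ^ 2 * τ ≤ (1 - l) * I ^ 2 := by
    have := mul_le_mul_of_nonneg_left hτ1 (mul_nonneg (sub_nonneg.2 hl1.le) (sq_nonneg I))
    linarith
  linarith

/-- `g ↦ m · K (m · g)`, where `m = exp (θ/2 1_A)`. -/
noncomputable def tiltedOperator (K : Kernel α α) (θ : ℝ) (A : Set α) (g : α → ℝ) (x : α) : ℝ :=
  tilt (θ / 2) A x * ∫ y, tilt (θ / 2) A y * g y ∂(K x)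

/-- `g ↦ K (e g)`, where `e = exp (θ 1_A)`. -/
noncomputable def weightedMean (K : Kernel α α) (e g : α → ℝ) (x : α) : ℝ :=
  ∫ y, e y * g y ∂(K x)

theorem tilt_mul_iterate_weightedMean (θ : ℝ) (A : Set α) (n : ℕ) (x : α) :
    tilt (θ / 2) A x * (weightedMean K (tilt θ A))^[n + 1] (fun _ => 1) x
      = tiltedOperator K θ A
          (fun y => tilt (θ / 2) A y * (weightedMean K (tilt θ A))^[n] (fun _ => 1) y) x := by
  rw [Function.iterate_succ_apply', weightedMean, tiltedOperator]
  simp_rw [← mul_assoc, tilt_half_mul_self]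

variable [IsMarkovKernel K] [IsProbabilityMeasure π]

theorem specSup₀_nonneg (hK : K.IsReversible π) : 0 ≤ specSup₀ K π hK := le_max_left _ _

theorem specSup₀_lt_one {hK : K.IsReversible π} (hVB : VarianceBounding K π hK) :
    specSup₀ K π hK < 1 := max_lt one_pos hVB

theorem markovForm_tilt_le {hK : K.IsReversible π} (hVB : VarianceBounding K π hK) (θ : ℝ)
    {A : Set α} (hA : MeasurableSet A) {g : α → ℝ} (hg : BddMeas g) :
    markovForm K π (fun x => tilt (θ / 2) A x * g x) (fun x => tilt (θ / 2) A x * g x)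
      ≤ mgfBound (specSup₀ K π hK) (π.real A) θ * ∫ x, g x ^ 2 ∂π :=
  (markovForm_self_le hK (((bddMeas_tilt _ hA).mul hg).memLp 2 π)).trans
    (quadratic_tilt_le (specSup₀_nonneg hK) (specSup₀_lt_one hVB) θ hA hg)

/-- Since `K` is positive, passing from `g` to `|g|` dominates the absolute value of the form, so no
lower spectral bound is needed. -/
theorem neg_markovForm_tilt_le {hK : K.IsReversible π} (hVB : VarianceBounding K π hK) (θ : ℝ)
    {A : Set α} (hA : MeasurableSet A) {g : α → ℝ} (hg : BddMeas g) :
    -markovForm K π (fun x => tilt (θ / 2) A x * g x) (fun x => tilt (θ / 2) A x * g x)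
      ≤ mgfBound (specSup₀ K π hK) (π.real A) θ * ∫ x, g x ^ 2 ∂π := by
  have h := markovForm_tilt_le hVB θ hA hg.abs
  simp only [sq_abs] at h
  refine le_trans ?_ h
  refine (neg_le_abs _).trans (abs_integral_le_integral_abs.trans_eq ?_)
  refine integral_congr_ae (Filter.Eventually.of_forall fun z => ?_)
  simp only [abs_mul, abs_of_pos (tilt_pos _ _ _)]

theorem bddMeas_tiltedOperator (θ : ℝ) {A : Set α} (hA : MeasurableSet A) {g : α → ℝ}
    (hg : BddMeas g) : BddMeas (tiltedOperator K θ A g) :=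
  (bddMeas_tilt _ hA).mul (((bddMeas_tilt _ hA).mul hg).kernelMean K)

/-- A symmetric `Q` with form bounded by `R` in absolute value has norm at most `R`: put `h = Q g`,
apply the two form bounds to `h + R g` and `h - R g`, and add. The cross terms give `4 R ‖h‖²`,
against `2 R (‖h‖² + R² ‖g‖²)`. -/
theorem integral_tiltedOperator_sq_le {hK : K.IsReversible π} (hVB : VarianceBounding K π hK)
    (θ : ℝ) {A : Set α} (hA : MeasurableSet A) {g : α → ℝ} (hg : BddMeas g) :
    ∫ x, tiltedOperator K θ A g x ^ 2 ∂π
      ≤ mgfBound (specSup₀ K π hK) (π.real A) θ ^ 2 * ∫ x, g x ^ 2 ∂π := by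
  set R := mgfBound (specSup₀ K π hK) (π.real A) θ with hR
  have hR0 : 0 < R := mgfBound_pos _ _ _
  have hm := bddMeas_tilt (θ / 2) hA
  set m := tilt (θ / 2) A
  set h := tiltedOperator K θ A g with hh
  have hhb : BddMeas h := bddMeas_tiltedOperator θ hA hg
  have h1 := markovForm_tilt_le hVB θ hA (hhb.add (hg.smul R))
  have h2 := neg_markovForm_tilt_le hVB θ hA (hhb.add (hg.smul (-R)))
  have expand : ∀ c : ℝ, markovForm K π (fun x => m x * (h + c • g) x) (fun x => m x * (h + c • g) x)
      = markovForm K π (fun x => m x * h x) (fun x => m x * h x)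
        + 2 * c * ∫ x, h x ^ 2 ∂π
        + c ^ 2 * markovForm K π (fun x => m x * g x) (fun x => m x * g x) := by
    intro c
    have e : (fun x => m x * (h + c • g) x) = (fun x => m x * h x) + c • (fun x => m x * g x) := by
      ext x; simp; ring
    have Lh := (hm.mul hhb).memLp 2 π
    have Lg := (hm.mul hg).memLp 2 π
    have e2 : markovForm K π (fun x => m x * h x) (fun x => m x * g x) = ∫ x, h x ^ 2 ∂π := by
      rw [markovForm_eq hK.invariant Lh Lg]
      refine integral_congr_ae (Filter.Eventually.of_forall fun x => ?_)
      simp only [hh, tiltedOperator]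
      ring
    have Lhg := Lh.add (Lg.const_smul c)
    rw [e, markovForm_add_left hK.invariant Lh (Lg.const_smul c) Lhg, markovForm_smul_left,
      markovForm_comm hK _ (_ + _), markovForm_comm hK (fun x => m x * g x) (_ + _),
      markovForm_add_left hK.invariant Lh (Lg.const_smul c) Lh,
      markovForm_add_left hK.invariant Lh (Lg.const_smul c) Lg, markovForm_smul_left,
      markovForm_smul_left, markovForm_comm hK (fun x => m x * g x) (fun x => m x * h x), e2]
    ring
  have expand2 : ∀ c : ℝ, ∫ x, (h + c • g) x ^ 2 ∂π
      = ∫ x, h x ^ 2 ∂π + 2 * c * ∫ x, h x * g x ∂π + c ^ 2 * ∫ x, g x ^ 2 ∂π := by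
    intro c
    have i1 : Integrable (fun x => h x ^ 2) π := (hhb.memLp 2 π).integrable_sq
    have i2 : Integrable (fun x => g x ^ 2) π := (hg.memLp 2 π).integrable_sq
    have i3 : Integrable (fun x => h x * g x) π := (hhb.mul hg).integrable π
    have i4 : Integrable (fun x => h x ^ 2 + 2 * c * (h x * g x)) π := i1.add (i3.const_mul _)
    rw [← integral_const_mul, ← integral_const_mul, ← integral_add i1 (i3.const_mul _),
      ← integral_add i4 (i2.const_mul _)]
    refine integral_congr_ae (Filter.Eventually.of_forall fun x => ?_)
    simp
    ring
  rw [expand, expand2] at h1 h2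
  set N := ∫ x, h x ^ 2 ∂π
  set G := ∫ x, g x ^ 2 ∂π
  have : 4 * R * N ≤ 2 * R * (R ^ 2 * G + N) := by linarith
  nlinarith

theorem bddMeas_iterate_weightedMean {e : α → ℝ} (he : BddMeas e) {g : α → ℝ} (hg : BddMeas g)
    (n : ℕ) : BddMeas ((weightedMean K e)^[n] g) := by
  induction n with
  | zero => exact hg
  | succ n ih =>
    rw [Function.iterate_succ_apply']
    exact (he.mul ih).kernelMean K

/-- The moment generating function of the occupation time of `A` for the stationary chain. -/
theorem integral_tilt_iterate_le {hK : K.IsReversible π} (hVB : VarianceBounding K π hK)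
    (θ : ℝ) {A : Set α} (hA : MeasurableSet A) (n : ℕ) :
    ∫ x, tilt θ A x * (weightedMean K (tilt θ A))^[n] (fun _ => 1) x ∂π
      ≤ mgfBound (specSup₀ K π hK) (π.real A) θ ^ (n + 1) := by
  set R := mgfBound (specSup₀ K π hK) (π.real A) θ with hR
  have hR0 : 0 < R := mgfBound_pos _ _ _
  have hm := bddMeas_tilt (θ / 2) hA
  have hG : ∀ n, BddMeas
      (fun y => tilt (θ / 2) A y * (weightedMean K (tilt θ A))^[n] (fun _ => 1) y) := fun n =>
    hm.mul (bddMeas_iterate_weightedMean (bddMeas_tilt θ hA) (BddMeas.const 1) n)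
  set M := ∫ x, tilt θ A x ∂π with hM
  have hMR : M ≤ R := integral_tilt_le (specSup₀_nonneg hK) (specSup₀_lt_one hVB) θ hA
  have hsq : ∀ n, ∫ x, (tilt (θ / 2) A x
      * (weightedMean K (tilt θ A))^[n] (fun _ => 1) x) ^ 2 ∂π ≤ (R ^ n) ^ 2 * M := by
    intro n
    induction n with
    | zero => simp [sq, tilt_half_mul_self, hM]
    | succ n ih =>
      simp_rw [tilt_mul_iterate_weightedMean]
      refine (integral_tiltedOperator_sq_le hVB θ hA (hG n)).trans ?_
      rw [← hR]
      calc R ^ 2 * _ ≤ R ^ 2 * ((R ^ n) ^ 2 * M) := by gcongr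
        _ = _ := by ring
  have i1 : Integrable (fun x => tilt θ A x) π := (bddMeas_tilt θ hA).integrable π
  have i2 : Integrable (fun x => (tilt (θ / 2) A x
      * (weightedMean K (tilt θ A))^[n] (fun _ => 1) x) ^ 2) π := ((hG n).memLp 2 π).integrable_sq
  have i3 : Integrable (fun x => tilt θ A x * (weightedMean K (tilt θ A))^[n] (fun _ => 1) x) π :=
    ((bddMeas_tilt θ hA).mul
      (bddMeas_iterate_weightedMean (bddMeas_tilt θ hA) (BddMeas.const 1) n)).integrable π
  -- Cauchy–Schwarz for `⟨m, Qⁿ m⟩` in AM–GM form, with weight `R ^ n`. The last factor `R` comes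
  -- from `M ≤ R`.
  have key : ∫ x, 2 * R ^ n * (tilt θ A x * (weightedMean K (tilt θ A))^[n] (fun _ => 1) x) ∂π
      ≤ ∫ x, ((R ^ n) ^ 2 * tilt θ A x + (tilt (θ / 2) A x
      * (weightedMean K (tilt θ A))^[n] (fun _ => 1) x) ^ 2) ∂π := by
    refine integral_mono (i3.const_mul _) ((i1.const_mul _).add i2) fun x => ?_
    simp only
    rw [← tilt_half_mul_self]
    nlinarith [sq_nonneg (R ^ n * tilt (θ / 2) A x
      - tilt (θ / 2) A x * (weightedMean K (tilt θ A))^[n] (fun _ => 1) x)]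
  rw [integral_const_mul, integral_add (i1.const_mul _) i2, integral_const_mul, ← hM] at key
  have hRn : 0 < R ^ n := pow_pos hR0 n
  have h1 := hsq n
  have h2 : ∫ x, tilt θ A x * (weightedMean K (tilt θ A))^[n] (fun _ => 1) x ∂π ≤ R ^ n * M := by
    refine le_of_mul_le_mul_left ?_ (mul_pos two_pos hRn)
    nlinarith
  refine h2.trans ?_
  rw [pow_succ]
  gcongr

end Moment

/-! ### The driven chain: Feynman–Kac formula and Hoeffding's inequality -/

section Path

variable {α : Type*} [MeasurableSpace α] {s : ℕ}

/-- The state at time `i` of the chain started at `x` and driven by `v`. -/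
noncomputable def chainState {β γ : Type*} (φ : β → γ → β) {k : ℕ} (x : β) (v : Fin k → γ)
    (i : Fin (k + 1)) : β :=
  iterUpdate φ i x (fun j : Fin (i : ℕ) => v (Fin.castLE (Nat.le_of_lt_succ i.isLt) j))

theorem measurable_finInit {γ : Type*} [MeasurableSpace γ] (k : ℕ) :
    Measurable (fun v : Fin (k + 1) → γ => (Fin.init v : Fin k → γ)) :=
  measurable_pi_lambda _ fun i => measurable_pi_apply (Fin.castSucc i)

theorem measurable_iterUpdate {γ : Type*} [MeasurableSpace γ] {φ : α → γ → α}
    (hφ : Measurable (Function.uncurry φ)) (k : ℕ) :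
    Measurable (fun z : α × (Fin k → γ) => iterUpdate φ k z.1 z.2) := by
  induction k with
  | zero => exact measurable_fst
  | succ k ih =>
    have h1 : Measurable (fun z : α × (Fin (k + 1) → γ) => iterUpdate φ k z.1 (Fin.init z.2)) :=
      ih.comp (measurable_fst.prodMk ((measurable_finInit k).comp measurable_snd))
    exact hφ.comp (h1.prodMk ((measurable_pi_apply (Fin.last k)).comp measurable_snd))

theorem measurable_chainState {γ : Type*} [MeasurableSpace γ] {φ : α → γ → α}
    (hφ : Measurable (Function.uncurry φ)) {k : ℕ} (i : Fin (k + 1)) :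
    Measurable (fun z : α × (Fin k → γ) => chainState φ z.1 z.2 i) :=
  (measurable_iterUpdate hφ i).comp (measurable_fst.prodMk
    (measurable_pi_lambda _ fun _ => (measurable_pi_apply _).comp measurable_snd))

/-- `g ↦ K (e g)` for nonnegative extended functions. -/
noncomputable def lweightedMean (K : Kernel α α) (e g : α → ℝ≥0∞) (x : α) : ℝ≥0∞ :=
  ∫⁻ y, e y * g y ∂(K x)

theorem measurable_lweightedMean (K : Kernel α α) {e g : α → ℝ≥0∞} (he : Measurable e)
    (hg : Measurable g) : Measurable (lweightedMean K e g) :=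
  (he.mul hg).lintegral_kernel

theorem iterate_lweightedMean_ofReal {K : Kernel α α} [IsMarkovKernel K] {e g : α → ℝ}
    (he : BddMeas e) (he0 : ∀ x, 0 ≤ e x) (hg : BddMeas g) (hg0 : ∀ x, 0 ≤ g x) (n : ℕ) (x : α) :
    (lweightedMean K (fun y => ENNReal.ofReal (e y)))^[n] (fun y => ENNReal.ofReal (g y)) x
      = ENNReal.ofReal ((weightedMean K e)^[n] g x) ∧ 0 ≤ (weightedMean K e)^[n] g x := by
  induction n generalizing x with
  | zero => exact ⟨rfl, hg0 x⟩
  | succ n ih =>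
    rw [Function.iterate_succ_apply', Function.iterate_succ_apply']
    have h0 : ∀ y, 0 ≤ e y * (weightedMean K e)^[n] g y := fun y => mul_nonneg (he0 y) (ih y).2
    refine ⟨?_, integral_nonneg h0⟩
    rw [lweightedMean, weightedMean, ofReal_integral_eq_lintegral_ofReal
      ((he.mul (bddMeas_iterate_weightedMean he hg n)).integrable _)
      (Filter.Eventually.of_forall h0)]
    refine lintegral_congr fun y => ?_
    rw [(ih y).1, ENNReal.ofReal_mul (he0 y)]

theorem IsUpdateFunction.map_eq {K : Kernel α α} {φ : α → Cube s → α}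
    (hφ : IsUpdateFunction K φ) (x : α) : (volume : Measure (Cube s)).map (φ x) = K x := by
  have hm : Measurable (φ x) := hφ.measurable.comp measurable_prodMk_left
  ext A hA
  rw [Measure.map_apply hm hA, hφ.kernel_eq x A hA]
  rfl

theorem IsUpdateFunction.lintegral_comp {K : Kernel α α} {φ : α → Cube s → α}
    (hφ : IsUpdateFunction K φ) (x : α) {g : α → ℝ≥0∞} (hg : Measurable g) :
    ∫⁻ u, g (φ x u) = ∫⁻ y, g y ∂(K x) := by
  have hm : Measurable (φ x) := hφ.measurable.comp measurable_prodMk_left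
  rw [← hφ.map_eq x, lintegral_map hg hm]

theorem IsGeneratorFunction.lintegral_comp {ν : Measure α} {ψ : Cube s → α}
    (hψ : IsGeneratorFunction ν ψ) {g : α → ℝ≥0∞} (hg : Measurable g) :
    ∫⁻ u, g (ψ u) = ∫⁻ y, g y ∂ν := by
  have : ν = (volume : Measure (Cube s)).map ψ := by
    ext A hA
    rw [Measure.map_apply hψ.measurable hA, hψ.measure_eq A hA]
    rfl
  rw [this, lintegral_map hg hψ.measurable]

theorem lintegral_init_last {γ : Type*} [MeasureSpace γ] [SigmaFinite (volume : Measure γ)]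
    {k : ℕ} {F : (Fin k → γ) → γ → ℝ≥0∞} (hF : Measurable (Function.uncurry F)) :
    ∫⁻ v : Fin (k + 1) → γ, F (Fin.init v) (v (Fin.last k)) = ∫⁻ w, ∫⁻ u, F w u := by
  have hmp := volume_preserving_piFinSuccAbove (fun _ : Fin (k + 1) => γ) (Fin.last k)
  have h := hmp.lintegral_comp (f := fun z : γ × (Fin k → γ) => F z.2 z.1)
    (hF.comp measurable_swap)
  have e : ∀ v : Fin (k + 1) → γ, F (Fin.init v) (v (Fin.last k))
      = (fun z : γ × (Fin k → γ) => F z.2 z.1)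
        (MeasurableEquiv.piFinSuccAbove (fun _ : Fin (k + 1) => γ) (Fin.last k) v) := by
    intro v
    simp [MeasurableEquiv.piFinSuccAbove, Fin.insertNthEquiv, Fin.removeNth_last]
  simp_rw [e]
  rw [h]
  exact lintegral_prod_symm _ (hF.comp measurable_swap).aemeasurable

theorem lintegral_zero_tail {γ : Type*} [MeasureSpace γ] [SigmaFinite (volume : Measure γ)]
    {k : ℕ} {F : γ → (Fin k → γ) → ℝ≥0∞} (hF : Measurable (Function.uncurry F)) :
    ∫⁻ v : Fin (k + 1) → γ, F (v 0) (Fin.tail v) = ∫⁻ u, ∫⁻ w, F u w := by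
  have hmp := volume_preserving_piFinSuccAbove (fun _ : Fin (k + 1) => γ) 0
  have h := hmp.lintegral_comp (f := fun z : γ × (Fin k → γ) => F z.1 z.2) hF
  have e : ∀ v : Fin (k + 1) → γ, F (v 0) (Fin.tail v)
      = (fun z : γ × (Fin k → γ) => F z.1 z.2)
        (MeasurableEquiv.piFinSuccAbove (fun _ : Fin (k + 1) => γ) 0 v) := by
    intro v
    simp [MeasurableEquiv.piFinSuccAbove, Fin.insertNthEquiv, Fin.removeNth_zero]
  simp_rw [e]
  rw [h]
  exact lintegral_prod _ hF.aemeasurable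

/-- Feynman–Kac formula: integrating out the last driver point replaces `g` by `K (e g)`, hence the
induction over all `g`. With `e = 1` it gives the law at time `k`, with `e = exp (θ 1_B)` the
exponential moment of the visits. -/
theorem lintegral_prod_chainState {K : Kernel α α} {φ : α → Cube s → α}
    (hφ : IsUpdateFunction K φ) {e : α → ℝ≥0∞} (he : Measurable e) (k : ℕ) {g : α → ℝ≥0∞}
    (hg : Measurable g) (x : α) :
    ∫⁻ v : Fin k → Cube s, (∏ i, e (chainState φ x v i)) * g (iterUpdate φ k x v)
      = e x * (lweightedMean K e)^[k] g x := by
  induction k generalizing g with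
  | zero =>
    have h : ∀ v : Fin 0 → Cube s, (∏ i, e (chainState φ x v i)) = e x := fun v =>
      Fin.prod_univ_one _
    simp only [Function.iterate_zero, id, iterUpdate, h]
    simp
  | succ k ih =>
    have hst : ∀ i : Fin (k + 1), Measurable fun z : (Fin k → Cube s) × Cube s =>
        chainState φ x z.1 i := fun i =>
      (measurable_chainState hφ.measurable i).comp (measurable_const.prodMk measurable_fst)
    have hit : Measurable fun z : (Fin k → Cube s) × Cube s =>
        φ (iterUpdate φ k x z.1) z.2 :=
      hφ.measurable.comp (((measurable_iterUpdate hφ.measurable k).comp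
        (measurable_const.prodMk measurable_fst)).prodMk measurable_snd)
    let F : (Fin k → Cube s) → Cube s → ℝ≥0∞ := fun w u =>
      (∏ i, e (chainState φ x w i)) * (e (φ (iterUpdate φ k x w) u) * g (φ (iterUpdate φ k x w) u))
    have hF : Measurable (Function.uncurry F) := by
      refine Measurable.mul ?_ ((he.comp hit).mul (hg.comp hit))
      exact Finset.measurable_prod _ fun i _ => he.comp (hst i)
    have h1 : ∀ v : Fin (k + 1) → Cube s,
        (∏ i, e (chainState φ x v i)) * g (iterUpdate φ (k + 1) x v)
          = F (Fin.init v) (v (Fin.last k)) := by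
      intro v
      rw [Fin.prod_univ_castSucc, mul_assoc]
      rfl
    simp_rw [h1]
    rw [lintegral_init_last hF, Function.iterate_succ_apply, ← ih (measurable_lweightedMean K he hg)]
    refine lintegral_congr fun w => ?_
    have hm : Measurable fun u => e (φ (iterUpdate φ k x w) u) * g (φ (iterUpdate φ k x w) u) :=
      ((he.mul hg).comp hφ.measurable).comp measurable_prodMk_left
    simp only [F]
    rw [lintegral_const_mul _ hm]
    congr 1
    exact hφ.lintegral_comp (iterUpdate φ k x w) (he.mul hg)

theorem volume_zero_tail_eq {ν : Measure α} {ψ : Cube s → α} (hψ : IsGeneratorFunction ν ψ)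
    {k : ℕ} {S : Set (α × (Fin k → Cube s))} (hS : MeasurableSet S) :
    volume {u : Fin (k + 1) → Cube s | (ψ (u 0), Fin.tail u) ∈ S}
      = ∫⁻ x, volume {v : Fin k → Cube s | (x, v) ∈ S} ∂ν := by
  have hF : Measurable (Function.uncurry fun (u : Cube s) (w : Fin k → Cube s) =>
      S.indicator (fun _ => (1 : ℝ≥0∞)) (ψ u, w)) :=
    (measurable_const.indicator hS).comp
      ((hψ.measurable.comp measurable_fst).prodMk measurable_snd)
  have hm : Measurable fun u : Fin (k + 1) → Cube s => (ψ (u 0), (Fin.tail u : Fin k → Cube s)) :=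
    (hψ.measurable.comp (measurable_pi_apply 0)).prodMk
      (measurable_pi_lambda _ fun i => measurable_pi_apply _)
  have h1 := lintegral_zero_tail hF
  have h2 : ∀ x, ∫⁻ w : Fin k → Cube s, S.indicator (fun _ => (1 : ℝ≥0∞)) (x, w)
      = volume {v : Fin k → Cube s | (x, v) ∈ S} := fun x =>
    lintegral_indicator_one (measurable_prodMk_left hS)
  have h3 : ∫⁻ u : Fin (k + 1) → Cube s, S.indicator (fun _ => (1 : ℝ≥0∞)) (ψ (u 0), Fin.tail u)
      = volume {u : Fin (k + 1) → Cube s | (ψ (u 0), Fin.tail u) ∈ S} :=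
    lintegral_indicator_one (hm hS)
  rw [← h3, h1]
  simp_rw [h2]
  exact hψ.lintegral_comp (measurable_measure_prodMk_left hS)

theorem volume_pullBack {K : Kernel α α} [IsMarkovKernel K] {ν : Measure α}
    [IsProbabilityMeasure ν] {φ : α → Cube s → α}
    (hφ : IsUpdateFunction K φ) {ψ : Cube s → α} (hψ : IsGeneratorFunction ν ψ) (k : ℕ)
    {A : Set α} (hA : MeasurableSet A) :
    (volume : Measure (Fin (k + 1) → Cube s)).real (pullBack φ ψ k A)
      = ∫ x, (weightedMean K (fun _ => 1))^[k] (A.indicator fun _ => 1) x ∂ν := by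
  have hb : BddMeas (A.indicator fun _ => (1 : ℝ)) :=
    ⟨measurable_const.indicator hA, 1, fun x => by
      by_cases hx : x ∈ A <;> simp [hx]⟩
  have h0 : ∀ x, 0 ≤ A.indicator (fun _ => (1 : ℝ)) x := fun x =>
    Set.indicator_nonneg (fun _ _ => zero_le_one) x
  have hit := fun x => iterate_lweightedMean_ofReal (K := K) (BddMeas.const 1)
    (fun _ => zero_le_one) hb h0 k x
  have h1 := volume_zero_tail_eq hψ
    (S := {z : α × (Fin k → Cube s) | iterUpdate φ k z.1 z.2 ∈ A})
    (measurable_iterUpdate hφ.measurable k hA)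
  have h2 : ∀ x, volume {v : Fin k → Cube s | iterUpdate φ k x v ∈ A}
      = ENNReal.ofReal ((weightedMean K (fun _ => 1))^[k] (A.indicator fun _ => 1) x) := by
    intro x
    rw [← (hit x).1]
    have h3 := lintegral_prod_chainState hφ (e := fun _ => 1) measurable_const k
      (g := fun y => ENNReal.ofReal (A.indicator (fun _ => (1 : ℝ)) y))
      hb.measurable.ennreal_ofReal x
    simp only [Finset.prod_const_one, one_mul] at h3
    simp only [ENNReal.ofReal_one]
    rw [← h3]
    have hm : Measurable fun v : Fin k → Cube s => iterUpdate φ k x v :=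
      (measurable_iterUpdate hφ.measurable k).comp measurable_prodMk_left
    refine (lintegral_indicator_one (hm hA)).symm.trans ?_
    refine lintegral_congr fun v => ?_
    by_cases hv : iterUpdate φ k x v ∈ A <;> simp [hv, Set.indicator]
  have h4 : volume (pullBack φ ψ k A) = ENNReal.ofReal
      (∫ x, (weightedMean K (fun _ => 1))^[k] (A.indicator fun _ => 1) x ∂ν) := by
    rw [ofReal_integral_eq_lintegral_ofReal
      ((bddMeas_iterate_weightedMean (BddMeas.const 1) hb k).integrable _)
      (Filter.Eventually.of_forall fun x => (hit x).2)]
    simp_rw [← h2]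
    exact h1
  rw [measureReal_def, h4, ENNReal.toReal_ofReal (integral_nonneg fun x => (hit x).2)]

/-- The number of visits to `B` at the times `0, …, k`. -/
noncomputable def visits {β γ : Type*} (φ : β → γ → β) {k : ℕ} (B : Set β) (x : β)
    (v : Fin k → γ) : ℝ := ∑ i, B.indicator (fun _ => (1 : ℝ)) (chainState φ x v i)

theorem measurable_visits {γ : Type*} [MeasurableSpace γ] {φ : α → γ → α}
    (hφ : Measurable (Function.uncurry φ)) (k : ℕ) {B : Set α} (hB : MeasurableSet B) :
    Measurable (fun z : α × (Fin k → γ) => visits φ B z.1 z.2) :=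
  Finset.measurable_sum _ fun i _ =>
    (measurable_const.indicator hB).comp (measurable_chainState hφ i)

theorem lintegral_volume_visits_le {K : Kernel α α} [IsMarkovKernel K] {π : Measure α}
    [IsProbabilityMeasure π] {hK : K.IsReversible π} (hVB : VarianceBounding K π hK)
    {φ : α → Cube s → α} (hφ : IsUpdateFunction K φ) {B : Set α} (hB : MeasurableSet B)
    (k : ℕ) (θ a : ℝ) :
    ∫⁻ x, volume {v : Fin k → Cube s | a ≤ θ * visits φ B x v} ∂π
      ≤ ENNReal.ofReal (Real.exp (-a) * mgfBound (specSup₀ K π hK) (π.real B) θ ^ (k + 1)) := by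
  have ht := bddMeas_tilt θ hB
  have hit := fun x => iterate_lweightedMean_ofReal (K := K) ht
    (fun x => (tilt_pos θ B x).le) (BddMeas.const 1) (fun _ => zero_le_one) k x
  have hbm := ht.mul (bddMeas_iterate_weightedMean (K := K) ht (BddMeas.const 1) k)
  have h1 : ∀ x, volume {v : Fin k → Cube s | a ≤ θ * visits φ B x v}
      ≤ ENNReal.ofReal (Real.exp (-a) *
        (tilt θ B x * (weightedMean K (tilt θ B))^[k] (fun _ => 1) x)) := by
    intro x
    have h3 := lintegral_prod_chainState hφ (e := fun y => ENNReal.ofReal (tilt θ B y))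
      ht.measurable.ennreal_ofReal k (g := fun y => 1) measurable_const x
    have h4 := (hit x).1
    simp only [ENNReal.ofReal_one] at h4
    rw [h4, ← ENNReal.ofReal_mul (tilt_pos θ B x).le] at h3
    rw [ENNReal.ofReal_mul (Real.exp_pos _).le, ← h3]
    have hm : Measurable fun v : Fin k → Cube s => visits φ B x v :=
      (measurable_visits hφ.measurable k hB).comp measurable_prodMk_left
    rw [← lintegral_const_mul' _ _ ENNReal.ofReal_ne_top, ← lintegral_indicator_one
      (measurableSet_le measurable_const (hm.const_mul θ))]
    refine lintegral_mono fun v => ?_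
    by_cases hv : a ≤ θ * visits φ B x v
    · rw [Set.indicator_of_mem (by exact hv), mul_one,
        ← ENNReal.ofReal_prod_of_nonneg fun i _ => (tilt_pos θ B _).le,
        ← ENNReal.ofReal_mul (Real.exp_pos _).le]
      simp only [tilt]
      rw [← Real.exp_sum, ← Finset.mul_sum, ← Real.exp_add, Pi.one_apply, ENNReal.one_le_ofReal,
        Real.one_le_exp_iff]
      unfold visits at hv
      linarith
    · rw [Set.indicator_of_notMem (by exact hv)]
      exact bot_le
  refine (lintegral_mono h1).trans ?_
  rw [← ofReal_integral_eq_lintegral_ofReal ((hbm.integrable π).const_mul _)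
    (Filter.Eventually.of_forall fun x => mul_nonneg (Real.exp_pos _).le
      (mul_nonneg (tilt_pos θ B x).le (hit x).2)), integral_const_mul]
  refine ENNReal.ofReal_le_ofReal ?_
  gcongr
  exact integral_tilt_iterate_le hVB θ hB k

/-- Hoeffding's inequality for the stationary reversible chain. -/
theorem lintegral_volume_deviation_le {K : Kernel α α} [IsMarkovKernel K] {π : Measure α}
    [IsProbabilityMeasure π] {hK : K.IsReversible π} (hVB : VarianceBounding K π hK)
    {φ : α → Cube s → α} (hφ : IsUpdateFunction K φ) {B : Set α} (hB : MeasurableSet B)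
    (k : ℕ) {t : ℝ} (ht : 0 ≤ t) :
    ∫⁻ x, volume {v : Fin k → Cube s |
        ((k + 1 : ℕ) : ℝ) * t < |visits φ B x v - ((k + 1 : ℕ) : ℝ) * π.real B|} ∂π
      ≤ ENNReal.ofReal (2 * Real.exp (-(((k + 1 : ℕ) : ℝ) * t ^ 2
        / ((1 + specSup₀ K π hK) / (1 - specSup₀ K π hK))))) := by
  have hl := specSup₀_nonneg hK
  have hl1 := specSup₀_lt_one hVB
  set C := (1 + specSup₀ K π hK) / (1 - specSup₀ K π hK) with hC
  have hC0 : 0 < C := div_pos (by linarith) (by linarith)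
  set n : ℝ := ((k + 1 : ℕ) : ℝ) with hn
  set p := π.real B with hp
  -- The exponent `n θ² C / 4 - |θ| n t` is minimal at `|θ| = 2 t / C`, with value `-n t² / C`; the
  -- two signs of `θ` serve the two tails.
  have hbound : ∀ θ : ℝ, ∀ a : ℝ, a = n * (θ * p) + 2 * (n * t ^ 2 / C) → θ ^ 2 = (2 * t / C) ^ 2 →
      Real.exp (-a) * mgfBound (specSup₀ K π hK) p θ ^ (k + 1) = Real.exp (-(n * t ^ 2 / C)) := by
    intro θ a ha hθ
    rw [mgfBound, ← Real.exp_nat_mul, ← Real.exp_add, ← hC, ← hn, hθ, ha]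
    congr 1
    field_simp
    ring
  have hup := lintegral_volume_visits_le hVB hφ hB k (2 * t / C) (n * ((2 * t / C) * p)
    + 2 * (n * t ^ 2 / C))
  have hlo := lintegral_volume_visits_le hVB hφ hB k (-(2 * t / C)) (n * (-(2 * t / C) * p)
    + 2 * (n * t ^ 2 / C))
  rw [← hp, hbound _ _ rfl (by ring)] at hup hlo
  have hsub : ∀ x, volume {v : Fin k → Cube s | n * t < |visits φ B x v - n * p|}
      ≤ volume {v : Fin k → Cube s | n * ((2 * t / C) * p) + 2 * (n * t ^ 2 / C)
          ≤ (2 * t / C) * visits φ B x v}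
        + volume {v : Fin k → Cube s | n * (-(2 * t / C) * p) + 2 * (n * t ^ 2 / C)
          ≤ -(2 * t / C) * visits φ B x v} := by
    intro x
    refine (measure_mono fun v hv => ?_).trans (measure_union_le _ _)
    have hθ : 0 ≤ 2 * t / C := by positivity
    have e : 2 * (n * t ^ 2 / C) = (2 * t / C) * (n * t) := by field_simp
    rw [Set.mem_ofPred_eq] at hv
    rcases lt_abs.1 hv with h | h
    · left
      rw [Set.mem_ofPred_eq, e]
      nlinarith [mul_le_mul_of_nonneg_left h.le hθ]
    · right
      rw [Set.mem_ofPred_eq, e]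
      nlinarith [mul_le_mul_of_nonneg_left h.le hθ]
  refine (lintegral_mono hsub).trans ?_
  have hmeas : Measurable fun x => volume {v : Fin k → Cube s |
      n * ((2 * t / C) * p) + 2 * (n * t ^ 2 / C) ≤ (2 * t / C) * visits φ B x v} :=
    measurable_measure_prodMk_left (measurableSet_le measurable_const
      ((measurable_visits hφ.measurable k hB).const_mul _))
  rw [lintegral_add_left hmeas, two_mul (Real.exp _),
    ENNReal.ofReal_add (Real.exp_pos _).le (Real.exp_pos _).le]
  exact add_le_add hup hlo

end Path

/-! ### From the stationary to the initial distribution -/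

section ChangeOfMeasure

variable {α : Type*} [MeasurableSpace α] {π ν : Measure α} [IsProbabilityMeasure π]
  [IsProbabilityMeasure ν]

/-- Cauchy–Schwarz against the density, followed by `F² ≤ F`, which is where `F ≤ 1` enters. -/
theorem lintegral_le_lpNorm_mul_sqrt (hνπ : ν ≪ π)
    (hν : MemLp (fun x => (ν.rnDeriv π x).toReal) 2 π) {F : α → ℝ≥0∞} (hF : Measurable F)
    (hF1 : ∀ x, F x ≤ 1) {a : ℝ} (ha : ∫⁻ x, F x ∂π ≤ ENNReal.ofReal a) :
    ∫⁻ x, F x ∂ν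
      ≤ ENNReal.ofReal (lpNorm (fun x => (ν.rnDeriv π x).toReal) 2 π * √a) := by
  rw [← lintegral_rnDeriv_mul hνπ hF.aemeasurable]
  have h1 := ENNReal.lintegral_mul_le_Lp_mul_Lq π Real.HolderConjugate.two_two
    (Measure.measurable_rnDeriv ν π).aemeasurable hF.aemeasurable
  refine h1.trans ?_
  rw [ENNReal.ofReal_mul lpNorm_nonneg]
  gcongr
  · rw [← toReal_eLpNorm hν.1, ENNReal.ofReal_toReal hν.2.ne]
    rw [eLpNorm_eq_lintegral_rpow_enorm_toReal (by norm_num) (by norm_num)]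
    refine le_of_eq ?_
    simp only [ENNReal.toReal_ofNat]
    congr 1
    refine lintegral_congr_ae ?_
    filter_upwards [Measure.rnDeriv_lt_top ν π] with x hx
    rw [← ofReal_norm, Real.norm_of_nonneg ENNReal.toReal_nonneg,
      ENNReal.ofReal_toReal hx.ne]
  · have h2 : ∫⁻ x, F x ^ (2 : ℝ) ∂π ≤ ENNReal.ofReal a := by
      refine (lintegral_mono fun x => ?_).trans ha
      calc F x ^ (2 : ℝ) ≤ F x ^ (1 : ℝ) :=
            ENNReal.rpow_le_rpow_of_exponent_ge (hF1 x) (by norm_num)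
        _ = F x := ENNReal.rpow_one _
    refine (ENNReal.rpow_le_rpow h2 (by norm_num)).trans ?_
    rcases le_total 0 a with h | h
    · rw [ENNReal.ofReal_rpow_of_nonneg h (by norm_num), Real.sqrt_eq_rpow]
    · simp [ENNReal.ofReal_of_nonpos h]

theorem one_le_lpNorm_rnDeriv (hνπ : ν ≪ π)
    (hν : MemLp (fun x => (ν.rnDeriv π x).toReal) 2 π) :
    1 ≤ lpNorm (fun x => (ν.rnDeriv π x).toReal) 2 π := by
  have h := lintegral_le_lpNorm_mul_sqrt hνπ hν (F := fun _ => 1) measurable_const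
    (fun _ => le_rfl) (a := 1) (by simp)
  simpa using h

end ChangeOfMeasure

/-! ### Bias of the chain started from `ν` -/

section Bias

variable {α : Type*} [MeasurableSpace α] {K : Kernel α α} {π ν : Measure α} [IsMarkovKernel K]
  [IsProbabilityMeasure π] [IsProbabilityMeasure ν]

theorem markovOperatorZero_pow_centered (hK : K.Invariant π) {g : α → ℝ} (hg : BddMeas g)
    (i : ℕ) :
    (((markovOperatorZero K π hK ^ i) (centered (hg.memLp 2 π)) : L2Zero π) : Lp ℝ 2 π)
      =ᵐ[π] fun x => (weightedMean K (fun _ => 1))^[i] g x - ∫ y, g y ∂π := by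
  induction i with
  | zero => exact (memLp_centered (hg.memLp 2 π)).coeFn_toLp
  | succ i ih =>
    rw [pow_succ', mul_apply_eq_comp]
    set f := (markovOperatorZero K π hK ^ i) (centered (hg.memLp 2 π))
    change (markovOperator K π hK (f : Lp ℝ 2 π)) =ᵐ[π] _
    refine (markovOperator_coeFn hK _).trans ((kernelMean_congr hK ih).trans ?_)
    refine Filter.Eventually.of_forall fun x => ?_
    simp only [Function.iterate_succ_apply']
    rw [integral_sub ((bddMeas_iterate_weightedMean (BddMeas.const 1) hg i).integrable _)
      (integrable_const _)]
    simp [weightedMean]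

/-- Each summand is the pairing of `dν/dπ - 1` with `Tⁱ f`, where `f = 1_A - π(A)` has norm at most
1. The sum is estimated as a whole: the spectrum may reach `-1`, so `‖Tⁱ f‖` need not be bounded by
`lⁱ`. -/
theorem abs_sum_integral_iterate_sub_le {hK : K.IsReversible π} (hνπ : ν ≪ π)
    (hν : MemLp (fun x => (ν.rnDeriv π x).toReal) 2 π) {A : Set α} (hA : MeasurableSet A)
    (n : ℕ) :
    |∑ i ∈ Finset.range n,
        (∫ x, (weightedMean K (fun _ => 1))^[i] (A.indicator fun _ => 1) x ∂ν - π.real A)|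
      ≤ (∑ i ∈ Finset.range n, specSup₀ K π hK ^ i)
        * lpNorm (fun x => (ν.rnDeriv π x).toReal - 1) 2 π := by
  have hb : BddMeas (A.indicator fun _ => (1 : ℝ)) :=
    ⟨measurable_const.indicator hA, 1, fun x => by
      by_cases hx : x ∈ A <;> simp [hx]⟩
  have hh : MemLp (fun x => (ν.rnDeriv π x).toReal - 1) 2 π := hν.sub (memLp_const 1)
  have hp : ∫ x, A.indicator (fun _ => (1 : ℝ)) x ∂π = π.real A := by
    rw [integral_indicator_const _ hA]; simp
  set p := π.real A with hp'
  set T := markovOperatorZero K π hK.invariant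
  set f := centered (hb.memLp 2 π)
  set w : ℕ → α → ℝ := fun i => (weightedMean K (fun _ => 1))^[i] (A.indicator fun _ => 1)
  have hw : ∀ i, BddMeas (w i) := fun i => bddMeas_iterate_weightedMean (BddMeas.const 1) hb i
  have hae : ∀ i, (((T ^ i) f : L2Zero π) : Lp ℝ 2 π) =ᵐ[π] fun x => w i x - p := fun i => by
    have := markovOperatorZero_pow_centered hK.invariant hb i
    rwa [hp] at this
  have hwπ : ∀ i, ∫ x, (w i x - p) ∂π = 0 := fun i => by
    rw [← integral_congr_ae (hae i)]
    exact ((T ^ i) f).2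
  have hh1 : Integrable (fun x => (ν.rnDeriv π x).toReal) π := hν.integrable (by norm_num)
  have hinner : ∀ i, ∫ x, w i x ∂ν - p = inner ℝ (hh.toLp _) (((T ^ i) f : L2Zero π) : Lp ℝ 2 π) := by
    intro i
    rw [L2.inner_def]
    have e : ∫ x, inner ℝ (hh.toLp _ x) ((((T ^ i) f : L2Zero π) : Lp ℝ 2 π) x) ∂π
        = ∫ x, ((ν.rnDeriv π x).toReal * w i x - (p * (ν.rnDeriv π x).toReal + (w i x - p))) ∂π := by
      refine integral_congr_ae ?_
      filter_upwards [hh.coeFn_toLp, hae i] with x h1 h2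
      rw [h1, h2]
      simp
      ring
    have i1 : Integrable (fun x => (ν.rnDeriv π x).toReal * w i x) π :=
      hν.integrable_mul ((hw i).memLp 2 π)
    have i2 : Integrable (fun x => w i x - p) π := ((hw i).integrable π).sub (integrable_const _)
    have e1 : ∫ x, (ν.rnDeriv π x).toReal * w i x ∂π = ∫ x, w i x ∂ν :=
      integral_rnDeriv_smul hνπ
    have e2 : ∫ x, (ν.rnDeriv π x).toReal ∂π = 1 := by
      rw [Measure.integral_toReal_rnDeriv hνπ]; simp
    have i3 : Integrable (fun x => p * (ν.rnDeriv π x).toReal + (w i x - p)) π :=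
      (hh1.const_mul _).add i2
    rw [e, integral_sub i1 i3, integral_add (hh1.const_mul _) i2, integral_const_mul, hwπ, e1, e2]
    ring
  have hsum : ∑ i ∈ Finset.range n, (∫ x, w i x ∂ν - p)
      = inner ℝ (hh.toLp _) ((∑ i ∈ Finset.range n, (T ^ i) f : L2Zero π) : Lp ℝ 2 π) := by
    rw [Submodule.coe_sum, inner_sum]
    exact Finset.sum_congr rfl fun i _ => hinner i
  have hf1 : ‖f‖ ≤ 1 := by
    have h1 := norm_centered_sq (hb.memLp 2 π)
    have h2 : ∫ x, A.indicator (fun _ => (1 : ℝ)) x ^ 2 ∂π = p := by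
      rw [← hp]
      refine integral_congr_ae (Filter.Eventually.of_forall fun x => ?_)
      by_cases hx : x ∈ A <;> simp [hx]
    rw [h2, hp] at h1
    have h3 : p ≤ 1 := measureReal_le_one
    have h4 : ‖f‖ ^ 2 ≤ 1 ^ 2 := by
      rw [h1]; nlinarith [sq_nonneg p]
    exact (sq_le_sq₀ (norm_nonneg _) zero_le_one).1 h4
  have hS := norm_sum_pow_apply_le (isSymmetric_markovOperatorZero hK)
    (le_max_left 0 (specSup K π hK)) (neg_norm_sq_le_inner_markovOperatorZero hK.invariant)
    (inner_markovOperatorZero_le hK) n f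
  have hc0 : 0 ≤ ∑ i ∈ Finset.range n, specSup₀ K π hK ^ i :=
    Finset.sum_nonneg fun k _ => pow_nonneg (le_max_left _ _) k
  have hnorm : ‖hh.toLp _‖ = lpNorm (fun x => (ν.rnDeriv π x).toReal - 1) 2 π := by
    rw [Lp.norm_toLp, toReal_eLpNorm hh.1]
  rw [hsum, mul_comm, ← hnorm]
  refine (abs_real_inner_le_norm _ _).trans ?_
  refine mul_le_mul_of_nonneg_left ?_ (norm_nonneg _)
  exact hS.trans (mul_le_of_le_one_right hc0 hf1)

end Bias

/-! ### Union bound and bracketing -/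

section Main

theorem localDiscrepancy_eq {β : Type*} {s : ℕ} {φ : β → Cube s → β} {ψ : Cube s → β} {k : ℕ}
    (u : Fin (k + 1) → Cube s) (A : Set β) :
    localDiscrepancy φ ψ u A = (1 / ((k + 1 : ℕ) : ℝ)) * (visits φ A (ψ (u 0)) (Fin.tail u)
      - ∑ i ∈ Finset.range (k + 1),
        (volume : Measure (Fin (i + 1) → Cube s)).real (pullBack φ ψ i A)) := by
  rw [localDiscrepancy, Finset.sum_sub_distrib, visits, Finset.sum_range]
  rfl

theorem visits_mono {β γ : Type*} (φ : β → γ → β) {k : ℕ} {A B : Set β} (h : A ⊆ B) (x : β)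
    (v : Fin k → γ) : visits φ A x v ≤ visits φ B x v :=
  Finset.sum_le_sum fun _ _ => Set.indicator_le_indicator_of_subset h (fun _ => zero_le_one) _

variable {α : Type*} [MeasurableSpace α] {s : ℕ}

/-- A driver sequence along which the visits to all sets of a finite collection are close to
stationarity. -/
theorem exists_forall_abs_visits_sub_le {K : Kernel α α} [IsMarkovKernel K] {π : Measure α}
    [IsProbabilityMeasure π] {hK : K.IsReversible π} (hVB : VarianceBounding K π hK)
    {ν : Measure α} [IsProbabilityMeasure ν] (hνπ : ν ≪ π)
    (hν : MemLp (fun x => (ν.rnDeriv π x).toReal) 2 π)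
    {Γ : Finset (Set α)} (hΓ : ∀ C ∈ Γ, MeasurableSet C) (hΓe : ∅ ∈ Γ)
    {φ : α → Cube s → α} (hφ : IsUpdateFunction K φ)
    {ψ : Cube s → α} (hψ : IsGeneratorFunction ν ψ) (k : ℕ) {t : ℝ}
    (ht : t = √((1 + specSup₀ K π hK) / (1 - specSup₀ K π hK))
            * (√(2 * Real.log ((Γ.card : ℝ) ^ 2
                * lpNorm (fun x => (ν.rnDeriv π x).toReal) 2 π)) / √((k + 1 : ℕ) : ℝ))) :
    ∃ u : Fin (k + 1) → Cube s, ∀ B ∈ Γ,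
      |visits φ B (ψ (u 0)) (Fin.tail u) - ((k + 1 : ℕ) : ℝ) * π.real B|
        ≤ ((k + 1 : ℕ) : ℝ) * t := by
  classical
  set H := lpNorm (fun x => (ν.rnDeriv π x).toReal) 2 π with hH
  have hH1 : 1 ≤ H := one_le_lpNorm_rnDeriv hνπ hν
  have hl := specSup₀_nonneg hK
  have hl1 := specSup₀_lt_one hVB
  set C := (1 + specSup₀ K π hK) / (1 - specSup₀ K π hK) with hC
  have hC0 : 0 < C := div_pos (by linarith) (by linarith)
  have hN : 1 ≤ Γ.card := Finset.card_pos.2 ⟨_, hΓe⟩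
  set N : ℝ := (Γ.card : ℝ) with hNdef
  have hN1 : 1 ≤ N := by rw [hNdef]; exact_mod_cast hN
  have hNH : 1 ≤ N ^ 2 * H := one_le_mul_of_one_le_of_one_le (one_le_pow₀ hN1) hH1
  set n : ℝ := ((k + 1 : ℕ) : ℝ) with hn
  have hn0 : 0 < n := by rw [hn]; positivity
  have ht0 : 0 ≤ t := by rw [ht]; positivity
  have hexp : n * t ^ 2 / C = 2 * Real.log (N ^ 2 * H) := by
    rw [ht, mul_pow, div_pow, Real.sq_sqrt hC0.le, Real.sq_sqrt hn0.le,
      Real.sq_sqrt (mul_nonneg zero_le_two (Real.log_nonneg hNH))]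
    field_simp
  -- The choice of `t` is made for this: each set of the cover fails with `ν`-probability at most
  -- `√2 / N²`.
  have hval : H * √(2 * Real.exp (-(n * t ^ 2 / C))) = √2 / N ^ 2 := by
    rw [hexp, ← mul_neg, mul_comm (2 : ℝ) (-_), Real.exp_mul, Real.exp_neg,
      Real.exp_log (by positivity), Real.sqrt_mul zero_le_two]
    rw [show (2 : ℝ) = ((2 : ℕ) : ℝ) by norm_num, Real.rpow_natCast, Real.sqrt_sq (by positivity)]
    field_simp
  let bad : Set α → Set (Fin (k + 1) → Cube s) := fun B =>
    {u | n * t < |visits φ B (ψ (u 0)) (Fin.tail u) - n * π.real B|}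
  have hbad : ∀ B ∈ Γ, volume (bad B) ≤ ENNReal.ofReal (√2 / N ^ 2) := by
    intro B hB
    have hBm := hΓ B hB
    have hS : MeasurableSet {z : α × (Fin k → Cube s) |
        n * t < |visits φ B z.1 z.2 - n * π.real B|} :=
      measurableSet_lt measurable_const
        ((measurable_visits hφ.measurable k hBm).sub_const _).abs
    have h1 := volume_zero_tail_eq hψ hS
    have h2 := lintegral_le_lpNorm_mul_sqrt hνπ hν
      (F := fun x => volume {v : Fin k → Cube s | n * t < |visits φ B x v - n * π.real B|})
      (measurable_measure_prodMk_left hS) (fun x => prob_le_one)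
      (lintegral_volume_deviation_le hVB hφ hBm k ht0)
    rw [← hH, ← hC, ← hn, hval] at h2
    exact h1.le.trans h2
  -- The empty set never deviates and is left out; for `Γ = {∅}` the bound `√2` would otherwise
  -- exceed 1. For the rest, `(N - 1) √2 ≤ 2 (N - 1) < N²`.
  have hunion : volume (⋃ B ∈ Γ.erase ∅, bad B) < 1 := by
    refine (measure_biUnion_finset_le _ _).trans_lt ?_
    refine (Finset.sum_le_sum fun B hB => hbad B (Finset.mem_of_mem_erase hB)).trans_lt ?_
    rw [Finset.sum_const, Finset.card_erase_of_mem hΓe, ← ENNReal.ofReal_nsmul,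
      ENNReal.ofReal_lt_one, nsmul_eq_mul, Nat.cast_sub hN, ← hNdef, Nat.cast_one,
      mul_div_assoc', div_lt_one (by positivity)]
    have h2 : √2 ≤ 2 := by rw [Real.sqrt_le_left (by norm_num)]; norm_num
    nlinarith [mul_le_mul_of_nonneg_left h2 (sub_nonneg.2 hN1), sq_nonneg (N - 1)]
  obtain ⟨u, hu⟩ : ∃ u, u ∉ ⋃ B ∈ Γ.erase ∅, bad B := by
    by_contra! hcon
    rw [Set.eq_univ_of_forall hcon, measure_univ] at hunion
    exact lt_irrefl _ hunion
  refine ⟨u, fun B hB => ?_⟩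
  by_cases hBe : B = ∅
  · subst hBe
    simp only [visits, Set.indicator_empty, Finset.sum_const_zero, measureReal_empty, mul_zero,
      sub_zero, abs_zero]
    positivity
  · by_contra! hcon
    exact hu (Set.mem_biUnion (Finset.mem_erase.2 ⟨hBe, hB⟩) hcon)

theorem exists_pullBackDiscrepancy_le (K : Kernel α α) [IsMarkovKernel K]
    (π : Measure α) [IsProbabilityMeasure π] (hK : K.IsReversible π)
    (hVB : VarianceBounding K π hK)
    (ν : Measure α) [IsProbabilityMeasure ν] (hνπ : ν ≪ π)
    (hν : MemLp (fun x => (ν.rnDeriv π x).toReal) 2 π)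
    (𝒜 : Set (Set α)) (h𝒜 : ∀ A ∈ 𝒜, MeasurableSet A)
    (δ : ℝ) (hδ : 0 < δ) (Γ : Finset (Set α)) (hΓ : IsDeltaCover π 𝒜 δ Γ)
    (φ : α → Cube s → α) (hφ : IsUpdateFunction K φ)
    (ψ : Cube s → α) (hψ : IsGeneratorFunction ν ψ) (k : ℕ) :
    ∃ u : Fin (k + 1) → Cube s,
      pullBackDiscrepancy 𝒜 φ ψ u ≤
        √((1 + specSup₀ K π hK) / (1 - specSup₀ K π hK))
            * (√(2 * Real.log ((Γ.card : ℝ) ^ 2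
                * lpNorm (fun x => (ν.rnDeriv π x).toReal) 2 π)) / √((k + 1 : ℕ) : ℝ))
          + (1 - specSup₀ K π hK ^ (k + 1)) / (((k + 1 : ℕ) : ℝ) * (1 - specSup₀ K π hK))
            * lpNorm (fun x => (ν.rnDeriv π x).toReal - 1) 2 π
          + δ := by
  obtain ⟨t, ht⟩ : ∃ t, t = √((1 + specSup₀ K π hK) / (1 - specSup₀ K π hK))
            * (√(2 * Real.log ((Γ.card : ℝ) ^ 2
                * lpNorm (fun x => (ν.rnDeriv π x).toReal) 2 π)) / √((k + 1 : ℕ) : ℝ)) := ⟨_, rfl⟩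
  obtain ⟨u, hu⟩ := exists_forall_abs_visits_sub_le hVB hνπ hν hΓ.measurableSet hΓ.empty_mem hφ hψ
    k ht
  have hl := specSup₀_nonneg hK
  have hl1 := specSup₀_lt_one hVB
  rw [← ht]
  have ht0 : 0 ≤ t := by rw [ht]; positivity
  have hgeom : ∑ i ∈ Finset.range (k + 1), specSup₀ K π hK ^ i
      = (1 - specSup₀ K π hK ^ (k + 1)) / (1 - specSup₀ K π hK) := by
    rw [eq_div_iff (by linarith), ← geom_sum_mul_neg]
  have hc0 : 0 ≤ ∑ i ∈ Finset.range (k + 1), specSup₀ K π hK ^ i :=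
    Finset.sum_nonneg fun i _ => pow_nonneg hl i
  rw [div_mul_eq_div_div_swap, ← hgeom]
  set S := ∑ i ∈ Finset.range (k + 1), specSup₀ K π hK ^ i
  set D := lpNorm (fun x => (ν.rnDeriv π x).toReal - 1) 2 π
  have hD0 : 0 ≤ D := lpNorm_nonneg
  set n : ℝ := ((k + 1 : ℕ) : ℝ) with hn
  have hn0 : 0 < n := by rw [hn]; positivity
  -- Nonnegativity of the bound covers an empty `𝒜`, whose supremum is 0.
  refine ⟨u, Real.iSup_le ?_ (by positivity)⟩
  rintro ⟨A, hA⟩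
  have hAm := h𝒜 A hA
  obtain ⟨B, hB, E, hE, hBA, hAE, hBE⟩ := hΓ.exists_bracket A hA
  have hbias := abs_sum_integral_iterate_sub_le (hK := hK) hνπ hν hAm (k + 1)
  simp_rw [← volume_pullBack hφ hψ _ hAm] at hbias
  rw [Finset.sum_sub_distrib, Finset.sum_const, Finset.card_range, nsmul_eq_mul, ← hn] at hbias
  rw [localDiscrepancy_eq, abs_mul, abs_of_pos (by positivity), ← hn, one_div_mul_eq_div,
    div_le_iff₀ hn0]
  have e1 : (t + S / n * D + δ) * n = n * t + S * D + n * δ := by field_simp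
  rw [e1]
  set M := ∑ i ∈ Finset.range (k + 1),
    (volume : Measure (Fin (i + 1) → Cube s)).real (pullBack φ ψ i A)
  have hb := abs_le.1 (hu B hB)
  have he := abs_le.1 (hu E hE)
  have hm := abs_le.1 hbias
  have v1 := visits_mono φ hBA (ψ (u 0)) (Fin.tail u)
  have v2 := visits_mono φ hAE (ψ (u 0)) (Fin.tail u)
  -- Visits to `A` lie between those to `B` and `E`, and `π(B)`, `π(E)` differ from `π(A)` by at
  -- most `δ`. The bias is estimated for `A` itself, so it enters only once.
  rw [measureReal_sdiff (hBA.trans hAE) (hΓ.measurableSet B hB)] at hBE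
  have p1 : π.real B ≤ π.real A := measureReal_mono hBA
  have p2 : π.real A ≤ π.real E := measureReal_mono hAE
  have q1 : n * π.real E ≤ n * (π.real A + δ) := by gcongr; linarith
  have q2 : n * π.real A ≤ n * (π.real B + δ) := by gcongr; linarith
  rw [abs_le]
  constructor <;> linarith [hb.1, he.2, hm.1, hm.2]

end Main

end PullBack


theorem mainTheorem5 {d : ℕ} (G : Set (EuclideanSpace ℝ (Fin d)))
    (K : Kernel G G) [IsMarkovKernel K]
    (π : Measure G) [IsProbabilityMeasure π] (hK : K.IsReversible π)
    (hVB : PullBack.VarianceBounding K π hK)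
    (ν : Measure G) [IsProbabilityMeasure ν] (hνπ : ν ≪ π)
    (hν : MemLp (fun x => (ν.rnDeriv π x).toReal) 2 π)
    (𝒜 : Set (Set G)) (h𝒜 : ∀ A ∈ 𝒜, MeasurableSet A)
    (δ : ℝ) (hδ : 0 < δ) (Γ : Finset (Set G)) (hΓ : PullBack.IsDeltaCover π 𝒜 δ Γ)
    {s : ℕ} (φ : G → PullBack.Cube s → G) (hφ : PullBack.IsUpdateFunction K φ)
    (ψ : PullBack.Cube s → G) (hψ : PullBack.IsGeneratorFunction ν ψ)
    (n : ℕ) (hn : 1 ≤ n) :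
    ∃ u : Fin n → PullBack.Cube s,
      PullBack.pullBackDiscrepancy 𝒜 φ ψ u ≤
        √((1 + PullBack.specSup₀ K π hK) / (1 - PullBack.specSup₀ K π hK))
            * (√(2 * Real.log ((Γ.card : ℝ) ^ 2
                * lpNorm (fun x => (ν.rnDeriv π x).toReal) 2 π)) / √(n : ℝ))
          + (1 - PullBack.specSup₀ K π hK ^ n) / ((n : ℝ) * (1 - PullBack.specSup₀ K π hK))
            * lpNorm (fun x => (ν.rnDeriv π x).toReal - 1) 2 π
          + δ := by
  obtain ⟨k, rfl⟩ : ∃ k, n = k + 1 := ⟨n - 1, by omega⟩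
  exact PullBack.exists_pullBackDiscrepancy_le K π hK hVB ν hνπ hν 𝒜 h𝒜 δ hδ Γ hΓ φ hφ ψ hψ k
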